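/- **Setting.** Let $\rho,k\in C^1[0,+\infty)$ be positive on $[0,+\infty)$ with $\rho k\in C^2[0,+\infty)$ and $(\rho k)'(0)=0$, and let $\gamma$ be a real function on $[0,+\infty)$; extend $\rho,k,\gamma$ evenly to $\mathbb R$. Put $$\sigma(x)=\int_0^x\sqrt{\rho/k}\,d\xi,\qquad Q_1=\sqrt{\tfrac k\rho}\,\frac{(k\rho)'}{4k\rho},\qquad Q_2=\sqrt{\tfrac k\rho}\,Q_1'+Q_1^2,\qquad q=Q_2-\gamma,$$ and assume $\sigma(x)\to+\infty$ as $x\to+\infty$, $q\in L^\infty(0,+\infty)\cap C^1[0,+\infty)$, and $\sqrt{\rho/k}\;q\,\sigma\in L^1(0,+\infty)$. Let $L^2_\rho(\mathbb R)$ be the real $L^2$ space of the measure $\rho\,dx$ and let $\mathcal D_{\rho k}f=\sqrt{k/\rho}\,f'+Q_1f$, with $f'$ the distributional derivative. Let $\mathbb H^1=\{f\in L^2_\rho(\mathbb R):\mathcal D_{\rho k}f\in L^2_\rho(\mathbb R)\}$ with the norm $(\|f\|_{L^2_\rho}^2+\|\mathcal D_{\rho k}f\|_{L^2_\rho}^2)^{1/2}$,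 let $\mathbb H^{-1}=(\mathbb H^1)^*$, and let $\widehat{\mathbb H}^{\pm1}$ be the closed subspace of even elements of $\mathbb H^{\pm1}$. The space $L^2_\rho(\mathbb R)$ is embedded in $\mathbb H^{-1}$ by $\langle\langle f,\varphi\rangle\rangle=\int_{\mathbb R}f\varphi\rho\,dx$; the operator $\mathcal D_{\rho k}:L^2_\rho(\mathbb R)\to\mathbb H^{-1}$ is defined by $\langle\langle\mathcal D_{\rho k}f,\varphi\rangle\rangle=-\langle\langle f,\mathcal D_{\rho k}\varphi\rangle\rangle$; and $\delta\in\mathbb H^{-1}$ is given by $\langle\langle\delta,\varphi\rangle\rangle=\varphi(0)$ (value of the continuous representative). For $T>0$, $u\in L^\infty(0,T)$ and $W^0\in\widehat{\mathbb H}^1$ consider the system $$W_t=\mathcal D_{\rho k}^2W-qW-2\sqrt{(\rho k)(0)}\,u\,\delta\ \text{ on }\mathbb R\times(0,T),\qquad W(\cdot,0)=W^0. \tag{1}$$ A solution is a map $W:[0,T]\to\widehat{\mathbb H}^1$ with $W(\cdot,0)=W^0$ which is absolutely continuous as a map into $\mathbb H^{-1}$ and whose derivative $W_t$ (which then lies in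 $\widehat{\mathbb H}^{-1}$) satisfies the equation in $\mathbb H^{-1}$ for almost every $t\in(0,T)$. Let $\mathcal R_T(W^0)$ be the set of all $W^T\in\widehat{\mathbb H}^1$ for which there is a control $u\in L^\infty(0,T)$ such that (1) has a unique solution $W$, and this solution satisfies $W(\cdot,T)=W^T$. **Theorem.** For every $T>0$, each state $W^0\in\widehat{\mathbb H}^1$ is approximately controllable to every target state $W^T\in\widehat{\mathbb H}^1$ in the time $T$ with respect to (1); that is, $W^T$ belongs to the closure of $\mathcal R_T(W^0)$ in $\widehat{\mathbb H}^1$. -/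

import Mathlib

open MeasureTheory Set Filter Topology
open scoped ContDiff

noncomputable section

namespace HeatControl

/-! ### Weak derivatives on the line -/

/-- `h ∈ L¹_loc(ℝ)` is the distributional derivative of `f ∈ L¹_loc(ℝ)`. -/
def HasWeakDeriv (f h : ℝ → ℝ) : Prop :=
  LocallyIntegrable f ∧ LocallyIntegrable h ∧
    ∀ φ : ℝ → ℝ, ContDiff ℝ ∞ φ → HasCompactSupport φ →
      ∫ x, f x * deriv φ x = - ∫ x, h x * φ x

lemma HasWeakDeriv.add {f₁ f₂ h₁ h₂ : ℝ → ℝ} (H₁ : HasWeakDeriv f₁ h₁)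
    (H₂ : HasWeakDeriv f₂ h₂) : HasWeakDeriv (f₁ + f₂) (h₁ + h₂) := by
  refine ⟨H₁.1.add H₂.1, H₁.2.1.add H₂.2.1, fun φ hφ hc => ?_⟩
  have hd : Continuous (deriv φ) := hφ.continuous_deriv (by simp)
  have i1 : ∀ g : ℝ → ℝ, LocallyIntegrable g → Integrable (fun x => g x * φ x) := fun g hg => by
    simpa [mul_comm] using hg.integrable_smul_left_of_hasCompactSupport hφ.continuous hc
  have i2 : ∀ g : ℝ → ℝ, LocallyIntegrable g → Integrable (fun x => g x * deriv φ x) :=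
    fun g hg => by
      simpa [mul_comm] using hg.integrable_smul_left_of_hasCompactSupport hd hc.deriv
  simp only [Pi.add_apply, add_mul]
  rw [integral_add (i2 _ H₁.1) (i2 _ H₂.1), integral_add (i1 _ H₁.2.1) (i1 _ H₂.2.1),
    H₁.2.2 φ hφ hc, H₂.2.2 φ hφ hc]
  ring

lemma HasWeakDeriv.smul {f h : ℝ → ℝ} (c : ℝ) (H : HasWeakDeriv f h) :
    HasWeakDeriv (c • f) (c • h) := by
  refine ⟨H.1.smul c, H.2.1.smul c, fun φ hφ hc => ?_⟩
  simp only [Pi.smul_apply, smul_eq_mul, mul_assoc]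
  rw [integral_const_mul, integral_const_mul, H.2.2 φ hφ hc]
  ring

lemma locallyIntegrable_congr_ae {f g : ℝ → ℝ} (hf : LocallyIntegrable f) (h : f =ᵐ[volume] g) :
    LocallyIntegrable g := by
  intro x
  obtain ⟨s, hs, hi⟩ := hf x
  exact ⟨s, hs, hi.congr (ae_restrict_of_ae h)⟩

lemma HasWeakDeriv.congr_left {f g h : ℝ → ℝ} (H : HasWeakDeriv f h) (e : f =ᵐ[volume] g) :
    HasWeakDeriv g h := by
  refine ⟨locallyIntegrable_congr_ae H.1 e, H.2.1, fun φ hφ hc => ?_⟩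
  rw [← H.2.2 φ hφ hc]
  refine integral_congr_ae ?_
  filter_upwards [e] with x hx
  rw [hx]

lemma hasWeakDeriv_zero : HasWeakDeriv 0 0 :=
  ⟨locallyIntegrable_zero, locallyIntegrable_zero, fun φ _ _ => by simp⟩

lemma ac_primitive {h : ℝ → ℝ} (hh : LocallyIntegrable h) (c a b : ℝ) :
    AbsolutelyContinuousOnInterval (fun x => c + ∫ t in (0 : ℝ)..x, h t) a b := by
  have hi : ∀ a b : ℝ, IntervalIntegrable h volume a b := fun a b => by
    rw [intervalIntegrable_iff']
    exact hh.integrableOn_isCompact isCompact_uIcc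
  have h1 := (hi a b).absolutelyContinuousOnInterval_intervalIntegral (c := a) left_mem_uIcc
  have hc : AbsolutelyContinuousOnInterval (fun _ : ℝ => c + ∫ t in (0 : ℝ)..a, h t) a b :=
    ((LipschitzWith.const (c + ∫ t in (0 : ℝ)..a, h t)).lipschitzOnWith
      (s := uIcc a b)).absolutelyContinuousOnInterval
  have e : (fun x => c + ∫ t in (0 : ℝ)..x, h t) =
      (fun _ : ℝ => c + ∫ t in (0 : ℝ)..a, h t) + fun x => ∫ t in a..x, h t := by
    funext x
    simp only [Pi.add_apply]
    rw [add_assoc, intervalIntegral.integral_add_adjacent_intervals (hi _ _) (hi _ _)]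
  rw [e]
  exact hc.add h1

lemma deriv_primitive {h : ℝ → ℝ} (hh : LocallyIntegrable h) (c : ℝ) :
    deriv (fun x => c + ∫ t in (0 : ℝ)..x, h t) =ᵐ[volume] h := by
  filter_upwards [LocallyIntegrable.ae_hasDerivAt_integral hh] with x hx
  exact ((hx 0).const_add c).deriv

lemma continuous_primitive {h : ℝ → ℝ} (hh : LocallyIntegrable h) (c : ℝ) :
    Continuous (fun x => c + ∫ t in (0 : ℝ)..x, h t) := by
  refine continuous_const.add (intervalIntegral.continuous_primitive (fun a b => ?_) 0)
  rw [intervalIntegrable_iff']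
  exact hh.integrableOn_isCompact isCompact_uIcc

lemma integral_eq_interval {φ : ℝ → ℝ} {R : ℝ} (hR : 0 ≤ R)
    (hφ : ∀ x, x ∉ Ioo (-R) R → φ x = 0) : ∫ x, φ x = ∫ x in (-R)..R, φ x := by
  rw [intervalIntegral.integral_of_le (by linarith), setIntegral_eq_integral_of_forall_compl_eq_zero]
  intro x hx
  exact hφ x (fun h => hx (Ioo_subset_Ioc_self h))

lemma exists_radius {φ : ℝ → ℝ} (hc : HasCompactSupport φ) :
    ∃ R : ℝ, 0 < R ∧ ∀ x, x ∉ Ioo (-R) R → x ∉ tsupport φ := by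
  obtain ⟨R, hR⟩ := hc.isCompact.isBounded.subset_ball 0
  refine ⟨max R 1, by positivity, fun x hx hxs => hx ?_⟩
  have := hR hxs
  rw [Metric.mem_ball, dist_zero_right, Real.norm_eq_abs] at this
  exact abs_lt.mp (this.trans_le (le_max_left _ _))

lemma hasWeakDeriv_primitive {h : ℝ → ℝ} (hh : LocallyIntegrable h) :
    HasWeakDeriv (fun x => 0 + ∫ t in (0 : ℝ)..x, h t) h := by
  refine ⟨(continuous_primitive hh 0).locallyIntegrable, hh, fun φ hφ hc => ?_⟩
  obtain ⟨R, hR, hz⟩ := exists_radius hc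
  have hz1 : ∀ x, x ∉ Ioo (-R) R → φ x = 0 := fun x hx => image_eq_zero_of_notMem_tsupport (hz x hx)
  have hz2 : ∀ x, x ∉ Ioo (-R) R → deriv φ x = 0 := fun x hx => by
    by_contra hne
    exact hz x hx (support_deriv_subset (Function.mem_support.mpr hne))
  rw [integral_eq_interval hR.le (fun x hx => by rw [hz2 x hx, mul_zero]),
    integral_eq_interval hR.le (fun x hx => by rw [hz1 x hx, mul_zero])]
  have hφac : AbsolutelyContinuousOnInterval φ (-R) R :=
    ((hφ.of_le (by simp)).contDiffOn (s := uIcc (-R) R)).absolutelyContinuousOnInterval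
  rw [(ac_primitive hh 0 (-R) R).integral_mul_deriv_eq_deriv_mul hφac,
    hz1 R (by simp), hz1 (-R) (by simp), mul_zero, mul_zero, sub_zero, zero_sub]
  congr 1
  refine intervalIntegral.integral_congr_ae ?_
  filter_upwards [deriv_primitive hh 0] with x hx _
  rw [hx]

/-- A function with weak derivative `h` is a.e. equal to a primitive of `h`. -/
lemma HasWeakDeriv.exists_primitive {f h : ℝ → ℝ} (H : HasWeakDeriv f h) :
    ∃ c : ℝ, f =ᵐ[volume] fun x => c + ∫ t in (0 : ℝ)..x, h t := by
  have hw : HasWeakDeriv (f + (-1 : ℝ) • fun x => 0 + ∫ t in (0 : ℝ)..x, h t)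
      (h + (-1 : ℝ) • h) := H.add ((hasWeakDeriv_primitive H.2.1).smul (-1))
  set w : ℝ → ℝ := f + (-1 : ℝ) • fun x => 0 + ∫ t in (0 : ℝ)..x, h t with hwdef
  have hw0 : ∀ φ : ℝ → ℝ, ContDiff ℝ ∞ φ → HasCompactSupport φ → ∫ x, w x * deriv φ x = 0 := by
    intro φ hφ hc
    rw [hw.2.2 φ hφ hc]
    simp
  let B : ContDiffBump (0 : ℝ) := ⟨1, 2, one_pos, one_lt_two⟩
  let b : ℝ → ℝ := B.normed volume
  have hb : ContDiff ℝ ∞ b := B.contDiff_normed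
  have hbc : HasCompactSupport b := B.hasCompactSupport_normed
  have hb1 : ∫ x, b x = 1 := B.integral_normed
  have int1 : ∀ g : ℝ → ℝ, Continuous g → HasCompactSupport g →
      Integrable (fun x => w x * g x) := fun g hg hgc => by
    simpa [mul_comm] using hw.1.integrable_smul_left_of_hasCompactSupport hg hgc
  refine ⟨∫ x, w x * b x, ?_⟩
  have key : ∀ᵐ x, w x = ∫ x, w x * b x := by
    refine ae_eq_of_integral_contDiff_smul_eq hw.1 (locallyIntegrable_const _) fun g hg hgc => ?_
    set m : ℝ := ∫ x, g x with hm
    let p : ℝ → ℝ := fun x => g x - m * b x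
    have hp : ContDiff ℝ ∞ p := hg.sub (contDiff_const.mul hb)
    have hpc : HasCompactSupport p := hgc.sub (hbc.mul_left)
    obtain ⟨R, hR, hz⟩ := exists_radius hpc
    have hz1 : ∀ x, x ∉ Ioo (-R) R → p x = 0 :=
      fun x hx => image_eq_zero_of_notMem_tsupport (hz x hx)
    have hp0 : ∫ x, p x = 0 := by
      rw [integral_sub (hg.continuous.integrable_of_hasCompactSupport hgc)
        ((hb.continuous.integrable_of_hasCompactSupport hbc).const_mul m), integral_const_mul,
        hb1, mul_one, sub_self]
    let P : ℝ → ℝ := fun x => ∫ t in (-R)..x, p t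
    have hPd : ∀ x, HasDerivAt P (p x) x := fun x =>
      intervalIntegral.integral_hasDerivAt_right (hp.continuous.intervalIntegrable _ _)
        (hp.continuous.stronglyMeasurableAtFilter _ _) hp.continuous.continuousAt
    have hdP : deriv P = p := funext fun x => (hPd x).deriv
    have hP : ContDiff ℝ ∞ P := by
      rw [contDiff_infty_iff_deriv, hdP]
      exact ⟨fun x => (hPd x).differentiableAt, hp⟩
    have hPc : HasCompactSupport P := by
      refine HasCompactSupport.of_support_subset_isCompact (isCompact_Icc (a := -R) (b := R)) ?_
      intro x hx
      by_contra hxn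
      apply hx
      rw [mem_Icc, not_and_or, not_le, not_le] at hxn
      rcases hxn with h1 | h1
      · change ∫ t in (-R)..x, p t = 0
        rw [intervalIntegral.integral_congr (g := fun _ => 0)]
        · simp
        · intro t ht
          rw [uIcc_of_ge h1.le] at ht
          exact hz1 t (fun h => absurd h.1 (not_lt.mpr ht.2))
      · change ∫ t in (-R)..x, p t = 0
        rw [← intervalIntegral.integral_add_adjacent_intervals
          (hp.continuous.intervalIntegrable (-R) R) (hp.continuous.intervalIntegrable R x),
          ← integral_eq_interval hR.le hz1, hp0, zero_add,
          intervalIntegral.integral_congr (g := fun _ => 0)]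
        · simp
        · intro t ht
          rw [uIcc_of_le h1.le] at ht
          exact hz1 t (fun h => absurd h.2 (not_lt.mpr ht.1))
    have h0 := hw0 P hP hPc
    rw [hdP] at h0
    have e : (fun x => w x * p x) = fun x => w x * g x - m * (w x * b x) := by
      funext x; simp only [p]; ring
    rw [e, integral_sub (int1 g hg.continuous hgc) ((int1 b hb.continuous hbc).const_mul m),
      integral_const_mul, sub_eq_zero] at h0
    simp only [smul_eq_mul]
    rw [integral_mul_const, ← hm, ← h0]
    exact integral_congr_ae (Eventually.of_forall fun x => mul_comm _ _)
  filter_upwards [key] with x hx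
  simp only [hwdef, Pi.add_apply, Pi.smul_apply, smul_eq_mul] at hx
  simp only [hwdef, Pi.add_apply, Pi.smul_apply, smul_eq_mul]
  linarith

/-! ### The coefficients -/

/-- `Q₁(ρ, k) = √(k/ρ) (kρ)' / (4 kρ)`. -/
def Q1 (ρ k : ℝ → ℝ) (x : ℝ) : ℝ :=
  √(k x / ρ x) * deriv (fun y => k y * ρ y) x / (4 * (k x * ρ x))

/-- `Q₂(ρ, k) = √(k/ρ) (Q₁(ρ, k))' + (Q₁(ρ, k))²`. -/
def Q2 (ρ k : ℝ → ℝ) (x : ℝ) : ℝ :=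
  √(k x / ρ x) * deriv (Q1 ρ k) x + Q1 ρ k x ^ 2

/-- `σ(x) = ∫₀ˣ √(ρ/k)`. -/
def sigma (ρ k : ℝ → ℝ) (x : ℝ) : ℝ :=
  ∫ ξ in (0 : ℝ)..x, √(ρ ξ / k ξ)

/-- The data `ρ, k, γ` of the equation `w_t = (k w_x)_x / ρ + γ w` on the half-axis, identified
with their even extensions to `ℝ`. -/
structure Coefficients where
  ρ : ℝ → ℝ
  k : ℝ → ℝ
  γ : ℝ → ℝ
  ρ_even : ∀ x, ρ (-x) = ρ x
  k_even : ∀ x, k (-x) = k x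
  γ_even : ∀ x, γ (-x) = γ x
  ρ_pos : ∀ x, 0 ≤ x → 0 < ρ x
  k_pos : ∀ x, 0 ≤ x → 0 < k x
  ρ_contDiff : ContDiffOn ℝ 1 ρ (Ici 0)
  k_contDiff : ContDiffOn ℝ 1 k (Ici 0)
  ρk_contDiff : ContDiffOn ℝ 2 (fun x => ρ x * k x) (Ici 0)
  ρk_deriv_zero : HasDerivWithinAt (fun x => ρ x * k x) 0 (Ici 0) 0
  sigma_tendsto : Tendsto (sigma ρ k) atTop atTop
  q_bounded : ∃ M : ℝ, ∀ x, 0 ≤ x → |Q2 ρ k x - γ x| ≤ M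
  q_contDiff : ContDiffOn ℝ 1 (fun x => Q2 ρ k x - γ x) (Ici 0)
  q_integrable :
    IntegrableOn (fun x => √(ρ x / k x) * (Q2 ρ k x - γ x) * sigma ρ k x) (Ioi 0)

namespace Coefficients

variable (A : Coefficients)

/-- The potential `q = Q₂(ρ, k) - γ`. -/
def q (x : ℝ) : ℝ := Q2 A.ρ A.k x - A.γ x

/-- The measure `ρ(x) dx` on `ℝ`. -/
def μ : Measure ℝ := volume.withDensity fun x => ENNReal.ofReal (A.ρ x)

/-- The space `L²_ρ(ℝ)`. -/
abbrev L2 : Type := Lp ℝ 2 A.μ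

/-! Basic facts on the coefficients. -/

lemma even_abs {f : ℝ → ℝ} (hf : ∀ x, f (-x) = f x) (x : ℝ) : f |x| = f x := by
  rcases abs_choice x with h | h <;> rw [h]
  exact hf x

lemma continuous_of_even {f : ℝ → ℝ} (hf : ∀ x, f (-x) = f x) (hc : ContinuousOn f (Ici 0)) :
    Continuous f := by
  have : f = fun x => f |x| := funext fun x => (even_abs hf x).symm
  rw [this]
  exact hc.comp_continuous continuous_abs fun x => abs_nonneg x

lemma ρ_continuous : Continuous A.ρ := continuous_of_even A.ρ_even A.ρ_contDiff.continuousOn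

lemma k_continuous : Continuous A.k := continuous_of_even A.k_even A.k_contDiff.continuousOn

lemma ρ_pos' (x : ℝ) : 0 < A.ρ x := by
  rw [← even_abs A.ρ_even]; exact A.ρ_pos _ (abs_nonneg x)

lemma k_pos' (x : ℝ) : 0 < A.k x := by
  rw [← even_abs A.k_even]; exact A.k_pos _ (abs_nonneg x)

lemma deriv_kρ_continuous : Continuous (deriv fun y => A.k y * A.ρ y) := by
  set P : ℝ → ℝ := fun y => A.k y * A.ρ y with hP
  have hPe : ∀ x, P (-x) = P x := fun x => by simp only [hP, A.k_even, A.ρ_even]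
  have hPc : ContDiffOn ℝ 2 P (Ici 0) := by
    refine A.ρk_contDiff.congr fun x _ => ?_
    simp only [hP]; ring
  have hP0 : HasDerivWithinAt P 0 (Ici 0) 0 := by
    refine A.ρk_deriv_zero.congr (fun x _ => ?_) ?_ <;> simp only [hP] <;> ring
  set p : ℝ → ℝ := derivWithin P (Ici 0) with hp
  have hpc : ContinuousOn p (Ici 0) :=
    hPc.continuousOn_derivWithin (uniqueDiffOn_Ici 0) (by norm_num)
  have hp0 : p 0 = 0 := hP0.derivWithin (uniqueDiffOn_Ici 0 0 self_mem_Ici)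
  have hpos : ∀ x, 0 < x → deriv P x = p x := fun x hx =>
    (derivWithin_of_mem_nhds (Ici_mem_nhds hx)).symm
  have hodd : ∀ x, deriv P (-x) = - deriv P x := fun x => by
    have : (fun y => P (-y)) = P := funext hPe
    have h2 := deriv_comp_neg P x
    rw [this] at h2
    linarith
  have hzero : deriv P 0 = 0 := by
    have := hodd 0
    rw [neg_zero] at this
    linarith
  have h1 : ContinuousOn (deriv P) (Ici 0) := by
    refine hpc.congr fun x hx => ?_
    rcases (mem_Ici.mp hx).eq_or_lt with h | h
    · rw [← h, hzero, hp0]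
    · exact hpos x h
  have h2 : ContinuousOn (deriv P) (Iic 0) := by
    have : deriv P = fun x => - deriv P (-x) := funext fun x => by rw [hodd, neg_neg]
    rw [this]
    refine (h1.comp continuous_neg.continuousOn fun x hx => ?_).neg
    simpa using hx
  rw [← continuousOn_univ, ← Iic_union_Ici (a := (0 : ℝ))]
  exact h2.union_of_isClosed h1 isClosed_Iic isClosed_Ici

lemma Q1_continuous : Continuous (Q1 A.ρ A.k) := by
  refine Continuous.div (Continuous.mul (Real.continuous_sqrt.comp
    (A.k_continuous.div A.ρ_continuous fun x => (A.ρ_pos' x).ne')) A.deriv_kρ_continuous)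
    (continuous_const.mul (A.k_continuous.mul A.ρ_continuous)) fun x => ?_
  have := mul_pos (A.k_pos' x) (A.ρ_pos' x)
  positivity

lemma Q1_odd (x : ℝ) : Q1 A.ρ A.k (-x) = - Q1 A.ρ A.k x := by
  have : (fun y => A.k (-y) * A.ρ (-y)) = fun y => A.k y * A.ρ y := by
    funext y; rw [A.k_even, A.ρ_even]
  have h2 := deriv_comp_neg (fun y => A.k y * A.ρ y) x
  rw [this] at h2
  have h3 : deriv (fun y => A.k y * A.ρ y) (-x) = - deriv (fun y => A.k y * A.ρ y) x := by
    linarith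
  unfold Q1
  rw [h3, A.k_even, A.ρ_even]
  ring

lemma q_even (x : ℝ) : A.q (-x) = A.q x := by
  have h1 : (fun y => Q1 A.ρ A.k (-y)) = fun y => - Q1 A.ρ A.k y := funext A.Q1_odd
  have h2 := deriv_comp_neg (Q1 A.ρ A.k) x
  rw [h1, deriv.fun_neg] at h2
  unfold q Q2
  rw [A.γ_even, A.Q1_odd, A.k_even, A.ρ_even, ← neg_inj.mp h2]
  ring

lemma q_continuous : Continuous A.q := continuous_of_even A.q_even A.q_contDiff.continuousOn

lemma exists_q_bound : ∃ M : ℝ, ∀ x, |A.q x| ≤ M := by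
  obtain ⟨M, hM⟩ := A.q_bounded
  exact ⟨M, fun x => by rw [← even_abs A.q_even]; exact hM _ (abs_nonneg x)⟩

lemma volume_ac : (volume : Measure ℝ) ≪ A.μ :=
  withDensity_absolutelyContinuous' A.ρ_continuous.measurable.ennreal_ofReal.aemeasurable
    (Eventually.of_forall fun x => by simpa using A.ρ_pos' x)

instance : IsLocallyFiniteMeasure A.μ :=
  IsLocallyFiniteMeasure.withDensity_ofReal A.ρ_continuous

lemma integral_μ (F : ℝ → ℝ) : ∫ x, F x ∂A.μ = ∫ x, A.ρ x * F x := by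
  rw [μ, integral_withDensity_eq_integral_toReal_smul
    A.ρ_continuous.measurable.ennreal_ofReal (Eventually.of_forall fun x => ENNReal.ofReal_lt_top)]
  refine integral_congr_ae (Eventually.of_forall fun x => ?_)
  simp only [smul_eq_mul, ENNReal.toReal_ofReal (A.ρ_pos' x).le]

lemma integrable_μ (F : ℝ → ℝ) : Integrable F A.μ ↔ Integrable fun x => A.ρ x * F x := by
  rw [μ, integrable_withDensity_iff_integrable_smul'
    A.ρ_continuous.measurable.ennreal_ofReal
    (Eventually.of_forall fun x => ENNReal.ofReal_lt_top)]
  simp only [smul_eq_mul, ENNReal.toReal_ofReal (A.ρ_pos' _).le]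

/-! ### The spaces `ℍ¹`, `ℍ⁻¹` and `Ĥ¹` -/

/-- `g` is the function `𝔻_{ρk} f = √(k/ρ) f' + Q₁(ρ, k) f`, where `f'` is the distributional
derivative of `f`. -/
def IsD (f g : ℝ → ℝ) : Prop :=
  ∃ f' : ℝ → ℝ, HasWeakDeriv f f' ∧
    g =ᵐ[volume] fun x => √(A.k x / A.ρ x) * f' x + Q1 A.ρ A.k x * f x

/-- The modified Sobolev space `ℍ¹` of all `f ∈ L²_ρ(ℝ)` with `𝔻_{ρk} f ∈ L²_ρ(ℝ)`. An element is
stored as the pair `(f, 𝔻_{ρk} f)`, so that its norm is `(‖f‖² + ‖𝔻_{ρk} f‖²)^{1/2}` with the norms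
of `L²_ρ(ℝ)` on the right. -/
def H1 : Submodule ℝ (WithLp 2 (A.L2 × A.L2)) where
  carrier := {w | A.IsD w.fst w.snd}
  add_mem' := by
    rintro v w ⟨v', hv, hv'⟩ ⟨w', hw, hw'⟩
    have e1 := A.volume_ac.ae_eq (Lp.coeFn_add v.fst w.fst)
    have e2 := A.volume_ac.ae_eq (Lp.coeFn_add v.snd w.snd)
    refine ⟨v' + w', (hv.add hw).congr_left e1.symm, ?_⟩
    change ⇑(v.snd + w.snd) =ᵐ[volume] _
    filter_upwards [e1, e2, hv', hw'] with x h1 h2 h3 h4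
    rw [h2, Pi.add_apply, h3, h4, Pi.add_apply, WithLp.add_fst, h1, Pi.add_apply]
    ring
  zero_mem' := by
    have e1 := A.volume_ac.ae_eq (Lp.coeFn_zero ℝ 2 A.μ)
    refine ⟨0, hasWeakDeriv_zero.congr_left e1.symm, ?_⟩
    change ⇑(0 : A.L2) =ᵐ[volume] _
    filter_upwards [e1] with x h1
    rw [WithLp.zero_fst, h1]
    simp
  smul_mem' := by
    rintro c w ⟨w', hw, hw'⟩
    have e1 := A.volume_ac.ae_eq (Lp.coeFn_smul c w.fst)
    have e2 := A.volume_ac.ae_eq (Lp.coeFn_smul c w.snd)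
    refine ⟨c • w', (hw.smul c).congr_left e1.symm, ?_⟩
    change ⇑(c • w.snd) =ᵐ[volume] _
    filter_upwards [e1, e2, hw'] with x h1 h2 h3
    rw [h2, Pi.smul_apply, h3, WithLp.smul_fst, h1, Pi.smul_apply, Pi.smul_apply]
    simp only [smul_eq_mul]
    ring

/-- The dual space `ℍ⁻¹ = (ℍ¹)*` with the dual norm. -/
abbrev Hm1 : Type := StrongDual ℝ A.H1

/-- The inclusion `ℍ¹ ⊂ L²_ρ(ℝ)`. -/
def incl : A.H1 →L[ℝ] A.L2 := (WithLp.fstL 2 ℝ A.L2 A.L2).comp A.H1.subtypeL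

/-- The operator `𝔻_{ρk} : ℍ¹ → L²_ρ(ℝ)`. -/
def D : A.H1 →L[ℝ] A.L2 := (WithLp.sndL 2 ℝ A.L2 A.L2).comp A.H1.subtypeL

/-- The embedding `L²_ρ(ℝ) ⊂ ℍ⁻¹`, `⟨⟨f, φ⟩⟩ = ∫ f φ ρ dx`. -/
def ofL2 (f : A.L2) : A.Hm1 := (innerSL ℝ f).comp A.incl

/-- The operator `𝔻_{ρk} : L²_ρ(ℝ) → ℍ⁻¹`, `⟨⟨𝔻_{ρk} f, φ⟩⟩ = -⟨⟨f, 𝔻_{ρk} φ⟩⟩`. -/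
def Dm (f : A.L2) : A.Hm1 := -(innerSL ℝ f).comp A.D

lemma memLp_q_mul (f : A.L2) : MemLp (fun x => A.q x * f x) 2 A.μ := by
  obtain ⟨M, hM⟩ := A.exists_q_bound
  exact (Lp.memLp f).mul (memLp_top_of_bound A.q_continuous.aestronglyMeasurable M
    (Eventually.of_forall hM))

/-- The product `q f` for `f ∈ L²_ρ(ℝ)`. -/
def qMul (f : A.L2) : A.L2 := (A.memLp_q_mul f).toLp

lemma memLp_indicator {g : ℝ → ℝ} (hg : Continuous g) :
    MemLp ((Icc (0 : ℝ) 1).indicator g) 2 A.μ := by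
  obtain ⟨C, hC⟩ := (isCompact_Icc (a := (0 : ℝ)) (b := 1)).exists_bound_of_continuousOn
    hg.continuousOn
  have : IsFiniteMeasure (A.μ.restrict (Icc 0 1)) :=
    ⟨by simpa using isCompact_Icc.measure_lt_top⟩
  rw [memLp_indicator_iff_restrict measurableSet_Icc]
  exact MemLp.of_bound hg.aestronglyMeasurable C (ae_restrict_of_forall_mem measurableSet_Icc hC)

lemma inner_indicator {g : ℝ → ℝ} (hg : Continuous g) (f : A.L2) :
    inner ℝ (A.memLp_indicator hg).toLp f = ∫ x in (0 : ℝ)..1, A.ρ x * (g x * f x) := by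
  rw [MeasureTheory.L2.inner_def, intervalIntegral.integral_of_le zero_le_one,
    ← integral_Icc_eq_integral_Ioc, ← integral_indicator measurableSet_Icc]
  have e1 : ∫ x, inner ℝ ((A.memLp_indicator hg).toLp _ x) (f x) ∂A.μ
      = ∫ x, (Icc (0 : ℝ) 1).indicator g x * f x ∂A.μ := by
    refine integral_congr_ae ?_
    filter_upwards [(A.memLp_indicator hg).coeFn_toLp] with x hx
    rw [hx]
    simp [mul_comm]
  rw [e1, A.integral_μ]
  refine integral_congr_ae (Eventually.of_forall fun x => ?_)
  simp only []
  by_cases hx : x ∈ Icc (0 : ℝ) 1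
  · rw [indicator_of_mem hx, indicator_of_mem hx]
  · rw [indicator_of_notMem hx, indicator_of_notMem hx]
    simp

lemma intervalIntegrable_L2 {g : ℝ → ℝ} (hg : Continuous g) (f : A.L2) :
    IntervalIntegrable (fun x => A.ρ x * (g x * f x)) volume 0 1 := by
  have h1 : Integrable (fun x => (Icc (0 : ℝ) 1).indicator g x * f x) A.μ :=
    (A.memLp_indicator hg).integrable_mul (Lp.memLp f)
  rw [A.integrable_μ] at h1
  rw [intervalIntegrable_iff_integrableOn_Icc_of_le zero_le_one]
  refine (h1.integrableOn (s := Icc 0 1)).congr_fun (fun x hx => ?_) measurableSet_Icc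
  simp only [indicator_of_mem hx]

/-- Every `f ∈ ℍ¹` has a continuous representative, whose value at `0` is a bounded linear
functional of `f`. -/
theorem exists_delta : ∃ ℓ : A.Hm1, ∀ f : A.H1, ∃ F : ℝ → ℝ, Continuous F ∧
    F =ᵐ[volume] A.incl f ∧ ℓ f = F 0 := by
  have hS : Continuous fun x => √(A.ρ x / A.k x) :=
    Real.continuous_sqrt.comp (A.ρ_continuous.div A.k_continuous fun x => (A.k_pos' x).ne')
  have ha : Continuous fun x => (1 - (x - 1) * √(A.ρ x / A.k x) * Q1 A.ρ A.k x) / A.ρ x :=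
    (continuous_const.sub (((continuous_id.sub continuous_const).mul hS).mul A.Q1_continuous)).div
      A.ρ_continuous fun x => (A.ρ_pos' x).ne'
  have hb : Continuous fun x => (x - 1) * √(A.ρ x / A.k x) / A.ρ x :=
    ((continuous_id.sub continuous_const).mul hS).div A.ρ_continuous fun x => (A.ρ_pos' x).ne'
  refine ⟨(innerSL ℝ (A.memLp_indicator ha).toLp).comp A.incl +
    (innerSL ℝ (A.memLp_indicator hb).toLp).comp A.D, fun f => ?_⟩
  obtain ⟨h, hw, hD⟩ := f.2
  obtain ⟨c, hc⟩ := hw.exists_primitive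
  have hh := hw.2.1
  set F : ℝ → ℝ := fun x => c + ∫ t in (0 : ℝ)..x, h t with hF
  have hFc : Continuous F := continuous_primitive hh c
  refine ⟨F, hFc, hc.symm, ?_⟩
  have hl : AbsolutelyContinuousOnInterval (fun x : ℝ => x - 1) 0 1 :=
    ContDiffOn.absolutelyContinuousOnInterval (by fun_prop)
  have hi : IntervalIntegrable h volume 0 1 := by
    rw [intervalIntegrable_iff']
    exact hh.integrableOn_isCompact isCompact_uIcc
  have ibp := hl.integral_mul_deriv_eq_deriv_mul (ac_primitive hh c 0 1)
  have e1 : ∫ x in (0 : ℝ)..1, (x - 1) * deriv F x = ∫ x in (0 : ℝ)..1, (x - 1) * h x := by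
    refine intervalIntegral.integral_congr_ae ?_
    filter_upwards [deriv_primitive hh c] with x hx _
    rw [hx]
  have e2 : ∫ x in (0 : ℝ)..1, deriv (fun x : ℝ => x - 1) x * F x = ∫ x in (0 : ℝ)..1, F x := by
    refine intervalIntegral.integral_congr fun x _ => ?_
    simp
  rw [e1, e2] at ibp
  have e3 : F 0 = ∫ x in (0 : ℝ)..1, (F x + (x - 1) * h x) := by
    rw [intervalIntegral.integral_add (hFc.intervalIntegrable _ _)
      (hi.continuousOn_mul (by fun_prop)), ibp]
    simp [hF]
  rw [e3]
  change inner ℝ (A.memLp_indicator ha).toLp (A.incl f) +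
    inner ℝ (A.memLp_indicator hb).toLp (A.D f) = _
  rw [A.inner_indicator ha, A.inner_indicator hb, ← intervalIntegral.integral_add
    (A.intervalIntegrable_L2 ha _) (A.intervalIntegrable_L2 hb _)]
  refine intervalIntegral.integral_congr_ae ?_
  filter_upwards [hc, hD] with x h1 h2 _
  have h1' : A.incl f x = F x := h1
  have h2' : A.D f x = √(A.k x / A.ρ x) * h x + Q1 A.ρ A.k x * F x := by
    rw [← h1]; exact h2
  have hρ := A.ρ_pos' x
  have hk := A.k_pos' x
  have hs : √(A.ρ x / A.k x) * √(A.k x / A.ρ x) = 1 := by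
    rw [← Real.sqrt_mul (by positivity), div_mul_div_cancel₀ hk.ne', div_self hρ.ne',
      Real.sqrt_one]
  rw [h1', h2']
  field_simp
  linear_combination ((x - 1) * h x) * hs

/-- The Dirac distribution `δ ∈ ℍ⁻¹`: `⟨⟨δ, φ⟩⟩ = φ(0)`, the value at `0` of the continuous
representative of `φ`. -/
def delta : A.Hm1 := A.exists_delta.choose

theorem delta_apply (f : A.H1) (F : ℝ → ℝ) (hF : Continuous F) (h : F =ᵐ[volume] A.incl f) :
    A.delta f = F 0 := by
  obtain ⟨G, hG, hGf, e⟩ := A.exists_delta.choose_spec f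
  rw [delta, e, (hG.ae_eq_iff_eq volume hF).mp (hGf.trans h.symm)]

/-- The closed subspace `Ĥ¹` of all even elements of `ℍ¹`, with the norm of `ℍ¹`. -/
def EvenH1 : Submodule ℝ A.H1 where
  carrier := {f | ∀ᵐ x : ℝ, A.incl f (-x) = A.incl f x}
  add_mem' := by
    intro f g hf hg
    have e := A.volume_ac.ae_eq (Lp.coeFn_add (A.incl f) (A.incl g))
    have e' := (Measure.measurePreserving_neg (volume : Measure ℝ)).quasiMeasurePreserving.ae e
    simp only [mem_ofPred_eq, map_add] at *
    filter_upwards [hf, hg, e, e'] with x h1 h2 h3 h4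
    rw [h3, h4, Pi.add_apply, Pi.add_apply, h1, h2]
  zero_mem' := by
    have e := A.volume_ac.ae_eq (Lp.coeFn_zero ℝ 2 A.μ)
    have e' := (Measure.measurePreserving_neg (volume : Measure ℝ)).quasiMeasurePreserving.ae e
    simp only [mem_ofPred_eq, map_zero]
    filter_upwards [e, e'] with x h3 h4
    rw [h3, h4, Pi.zero_apply, Pi.zero_apply]
  smul_mem' := by
    intro c f hf
    have e := A.volume_ac.ae_eq (Lp.coeFn_smul c (A.incl f))
    have e' := (Measure.measurePreserving_neg (volume : Measure ℝ)).quasiMeasurePreserving.ae e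
    simp only [mem_ofPred_eq, map_smul] at *
    filter_upwards [hf, e, e'] with x h1 h3 h4
    rw [h3, h4, Pi.smul_apply, Pi.smul_apply, h1]

/-! ### The control system -/

/-- The inclusion `ℍ¹ ⊂ ℍ⁻¹`. -/
def embed (f : A.H1) : A.Hm1 := A.ofL2 (A.incl f)

/-- The right-hand side `𝔻²_{ρk} f - q f - 2 √((ρk)(0)) c δ ∈ ℍ⁻¹` for a state `f ∈ ℍ¹` and a
control value `c ∈ ℝ`. -/
def rhs (f : A.H1) (c : ℝ) : A.Hm1 :=
  A.Dm (A.D f) - A.ofL2 (A.qMul (A.incl f)) - (2 * √(A.ρ 0 * A.k 0) * c) • A.delta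

/-- `W : [0, T] → Ĥ¹` solves `W_t = 𝔻²_{ρk} W - q W - 2 √((ρk)(0)) u δ` on `(0, T)`, `W(0) = W⁰`:
as a map into `ℍ⁻¹` it is absolutely continuous on `[0, T]` and its derivative is the right-hand
side at almost every time. Values of `W` outside `[0, T]` play no role. -/
def IsSolution (T : ℝ) (u : ℝ → ℝ) (W0 : A.EvenH1) (W : ℝ → A.EvenH1) : Prop :=
  W 0 = W0 ∧
  AbsolutelyContinuousOnInterval (fun t => A.embed (W t)) 0 T ∧
  ∀ᵐ t, t ∈ Ioo 0 T → HasDerivAt (fun s => A.embed (W s)) (A.rhs (W t) (u t)) t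

/-- The set of all states `W^T ∈ Ĥ¹` for which there is a control `u ∈ L^∞(0, T)` such that the
system has a unique solution `W` with this control and initial state `W⁰`, and `W(T) = W^T`. -/
def reachableSet (T : ℝ) (W0 : A.EvenH1) : Set A.EvenH1 :=
  {WT | ∃ u : ℝ → ℝ, MemLp u ⊤ (volume.restrict (Ioo 0 T)) ∧
    ∃ W : ℝ → A.EvenH1, A.IsSolution T u W0 W ∧
      (∀ V : ℝ → A.EvenH1, A.IsSolution T u W0 V → EqOn V W (Icc 0 T)) ∧ W T = WT}

/-- `W⁰` is approximately controllable to `W^T` in time `T`; the closure is taken in `Ĥ¹`. -/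
def ApproxControllable (T : ℝ) (W0 WT : A.EvenH1) : Prop :=
  WT ∈ closure (A.reachableSet T W0)

end Coefficients

end HeatControl

end

/-!
Choose `λ > sup |q|` and let `Λ = -𝔻² + q + λ`, an isomorphism `ℍ¹ → ℍ⁻¹` given by a symmetric
coercive form `b` on `ℍ¹` (`Coefficients.triple`). The resolvent `R = Λ⁻¹` on `L²_ρ` satisfies
`0 ≤ R ≤ 1`, so that `f(R)` is defined for `f ∈ C[0, 1]` as a limit of polynomials in `R`
(`funCalc`), and `f(r) = r⁻ᵐ exp(-t/r)` gives `Λᵐ exp(-tΛ)` together with the bound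
`‖Λᵐ exp(-tΛ)‖ ≤ m! t⁻ᵐ`. The uncontrolled solution is `exp(λt) exp(-tΛ) W⁰`; it is Lipschitz as a
map into `ℍ⁻¹` because the semigroup is bounded on `ℍ¹`
(`FormTriple.exists_lipschitz_semigroup`). Uniqueness of solutions for every control is the energy
estimate for `N = b(g, g)`, `g = Λ⁻¹ W` (`FormTriple.eq_zero_of_evolution`).

By linearity it remains to show that the states reached from `W⁰ = 0` are dense in `Ĥ¹`. Let
`p = Λ⁻¹(κδ)`, `κ = 2 √((ρk)(0))`. The control `exp(λs) 1_{s > T - t}` produces an explicit solution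
which ends at `-exp(λT) (p - exp(-tΛ) p)` (`FormTriple.solves_step`). Hence `p - exp(-tΛ) p` is
reached for every `t ∈ [0, T]`, and it suffices that an even `y` with
`b(y, p - exp(-tΛ) p) = 0` for `0 < t < T` vanishes. The hypothesis says that `⟨⟨δ, exp(-tΛ) y⟩⟩` is
constant in `t`, and differentiation gives `⟨⟨δ, Λⁿ⁺¹ exp(-tΛ) y⟩⟩ = 0` for all `n`
(`FormTriple.apply_orbit_eq_zero`).

Now fix `t` and put `hₙ = Λⁿ⁺¹ exp(-tΛ) y`. In the Liouville variables `σ` and `(ρk)^{1/4} f` the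
operator `𝔻` becomes `d/dσ`, so that `Fₙ = (ρk)^{1/4} hₙ` satisfies `Fₙ'' = (q + λ) Fₙ - Fₙ₊₁`, with
`Fₙ(0) = 0` by the above and `Fₙ'(0) = 0` because `hₙ` is even. Since `Fₙ` is bounded on compact
sets by a multiple of `(n + 2)! t⁻ⁿ`, and `m` double integrations gain the factor `σ²ᵐ / (2m)!`, the
function `F₀` vanishes (`eq_zero_of_cauchy_data`, `Coefficients.eq_zero_of_delta_eq_zero`).
Therefore `exp(-tΛ) y = 0` for `0 < t < T`, and `t → 0` gives `y = 0`.
-/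

noncomputable section

namespace HeatControl

/-! ### Functional calculus of a self-adjoint operator `0 ≤ R ≤ 1` on a real Hilbert space -/

section FunctionalCalculus

variable {H : Type*} [NormedAddCommGroup H] [InnerProductSpace ℝ H] [CompleteSpace H]

open Polynomial

/-- The Lax–Milgram theorem. -/
lemma isUnit_of_coercive {T : H →L[ℝ] H} {c : ℝ} (hc : 0 < c)
    (h : ∀ x, c * ‖x‖ ^ 2 ≤ inner ℝ (T x) x) : IsUnit T := by
  have hco : IsCoercive ((innerSL ℝ).comp T) :=
    ⟨c, hc, fun u => by have := h u; rwa [sq, ← mul_assoc] at this⟩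
  have e : (hco.continuousLinearEquivOfBilin : H →L[ℝ] H) = T := by
    ext v
    refine ext_inner_right ℝ fun w => ?_
    simp [hco.continuousLinearEquivOfBilin_apply v w]
  rw [← e]
  exact ⟨ContinuousLinearEquiv.toUnit hco.continuousLinearEquivOfBilin, rfl⟩

/-- The operator inequality `0 ≤ R ≤ 1`, for a self-adjoint `R`. -/
structure IsEffect (R : H →L[ℝ] H) : Prop where
  selfAdjoint : IsSelfAdjoint R
  nonneg : ∀ x, 0 ≤ inner ℝ (R x) x
  le_one : ∀ x, inner ℝ (R x) x ≤ ‖x‖ ^ 2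

variable {R : H →L[ℝ] H}

/-- An irreducible real polynomial without zeros in `[0, 1]` is linear with its zero outside `[0, 1]`
or a definite quadratic; in both cases a multiple of `p(R)` is coercive. -/
lemma IsEffect.isUnit_aeval_of_irreducible (hR : IsEffect R) {p : ℝ[X]} (hp : Irreducible p)
    (h : ∀ r ∈ Icc (0 : ℝ) 1, p.eval r ≠ 0) : IsUnit (aeval R p) := by
  obtain ⟨a, b, c, e⟩ : ∃ a b c : ℝ, p = C a * X ^ 2 + C b * X + C c :=
    ⟨_, _, _, eq_quadratic_of_degree_le_two hp.degree_le_two⟩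
  have hev : ∀ r, p.eval r = a * r ^ 2 + b * r + c := fun r => by rw [e]; simp
  have hT : ∀ x, aeval R p x = a • R (R x) + b • R x + c • x := fun x => by
    rw [e]; simp [sq, Algebra.algebraMap_eq_smul_one]
  have hsym : ∀ x y, inner ℝ (R x) y = inner ℝ x (R y) := fun x y => hR.selfAdjoint.isSymmetric x y
  by_cases ha : a = 0
  · by_cases hb : b = 0
    · have hc : c ≠ 0 := by simpa [hev, ha, hb] using h 0 (by simp)
      have : aeval R p = c • (1 : H →L[ℝ] H) := by ext x; simp [hT, ha, hb]
      rw [this]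
      exact isUnit_one.smul (Units.mk0 c hc)
    · set r := -c / b with hr
      have hrb : c = -(r * b) := by rw [hr]; field_simp
      have hrI : r ∉ Icc (0 : ℝ) 1 := fun hI => h r hI (by rw [hev, ha, hrb]; ring)
      have e1 : aeval R p = b • (R - r • 1) := by
        ext x; rw [hT, ha, hrb]; simp [smul_smul, mul_comm, sub_eq_add_neg]
      rw [e1]
      refine IsUnit.smul (Units.mk0 b hb) ?_
      rw [mem_Icc, not_and_or, not_le, not_le] at hrI
      rcases hrI with h1 | h1
      · refine isUnit_of_coercive (neg_pos.mpr h1) fun x => ?_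
        have := hR.nonneg x
        simp only [sub_apply, smul_apply,
          one_apply_eq_self, inner_sub_left, inner_smul_left, real_inner_self_eq_norm_sq]
        simp only [conj_trivial]
        linarith
      · rw [← neg_sub]
        refine (isUnit_of_coercive (sub_pos.mpr h1) fun x => ?_).neg
        have := hR.le_one x
        simp only [sub_apply, smul_apply,
          one_apply_eq_self, inner_sub_left, inner_smul_left, real_inner_self_eq_norm_sq]
        simp only [conj_trivial]
        linarith
  · have hdeg : p.degree = 2 := by rw [e]; exact degree_quadratic ha
    have hd : b ^ 2 < 4 * a * c := by
      by_contra! hd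
      obtain ⟨r, hr⟩ := exists_quadratic_eq_zero ha (b := b) (c := c)
        ⟨√(discrim a b c), (Real.mul_self_sqrt (by rw [discrim]; linarith)).symm⟩
      have := degree_eq_one_of_irreducible_of_root hp (x := r)
        (by rw [IsRoot.def, hev]; linear_combination hr)
      rw [hdeg] at this
      norm_num at this
    -- complete the square: `4a p(R) = (2a R + b)² + (4ac - b²)`
    have hu : IsUnit ((4 * a) • aeval R p) := by
      refine isUnit_of_coercive (sub_pos.mpr hd) fun x => ?_
      have h1 : (0 : ℝ) ≤ inner ℝ ((2 * a) • R x + b • x) ((2 * a) • R x + b • x) :=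
        real_inner_self_nonneg
      simp only [smul_apply, hT, inner_add_left, inner_add_right,
        inner_smul_left, inner_smul_right, conj_trivial, hsym (R x) x, hsym x x,
        real_inner_self_eq_norm_sq] at h1 ⊢
      linarith
    have := hu.smul (Units.mk0 (4 * a) (by simpa using ha))⁻¹
    rwa [Units.smul_def, Units.val_inv_eq_inv_val, Units.val_mk0, smul_smul,
      inv_mul_cancel₀ (by simpa using ha), one_smul] at this

/-- Spectral mapping over `ℝ`: `p(R)` is invertible if `p` has no zero in `[0, 1]`. -/
lemma IsEffect.isUnit_aeval (hR : IsEffect R) (p : ℝ[X])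
    (h : ∀ r ∈ Icc (0 : ℝ) 1, p.eval r ≠ 0) : IsUnit (aeval R p) := by
  induction p using WfDvdMonoid.induction_on_irreducible with
  | zero => exact absurd (by simp) (h 0 (by simp))
  | unit u hu => exact hu.map (aeval R)
  | mul a i ha hi ih =>
    rw [map_mul]
    exact (hR.isUnit_aeval_of_irreducible hi fun r hr h0 => h r hr (by simp [h0])).mul
      (ih fun r hr h0 => h r hr (by simp [h0]))

lemma IsEffect.isSelfAdjoint_aeval (hR : IsEffect R) (p : ℝ[X]) : IsSelfAdjoint (aeval R p) := by
  induction p using Polynomial.induction_on' with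
  | add p q hp hq => rw [map_add]; exact hp.add hq
  | monomial n a =>
    rw [aeval_monomial, Algebra.algebraMap_eq_smul_one, smul_mul_assoc, one_mul]
    exact (IsSelfAdjoint.all a).smul (hR.selfAdjoint.pow n)

/-- The norm of the self-adjoint operator `p(R)` is its spectral radius, and its spectrum lies in
`p([0, 1])`. -/
lemma IsEffect.norm_aeval_le (hR : IsEffect R) (p : ℝ[X]) :
    ‖aeval R p‖ ≤ ‖p.toContinuousMapOn (Icc (0 : ℝ) 1)‖ := by
  have h := (aeval R p).spectralRadius_eq_nnnorm (hR.isSelfAdjoint_aeval p)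
  suffices hs : spectralRadius ℝ (aeval R p) ≤ ‖p.toContinuousMapOn (Icc (0 : ℝ) 1)‖₊ by
    rw [h] at hs
    exact_mod_cast hs
  refine iSup₂_le fun k hk => ?_
  obtain ⟨r, hr, h0⟩ : ∃ r ∈ Icc (0 : ℝ) 1, (C k - p).eval r = 0 := by
    by_contra! hne
    have := hR.isUnit_aeval _ hne
    rw [map_sub, aeval_C] at this
    exact hk this
  have hkr : k = p.toContinuousMapOn (Icc (0 : ℝ) 1) ⟨r, hr⟩ := by
    simpa [sub_eq_zero] using h0
  have := (p.toContinuousMapOn (Icc (0 : ℝ) 1)).norm_coe_le_norm ⟨r, hr⟩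
  rw [← hkr] at this
  exact_mod_cast this

lemma denseRange_toContinuousMapOn :
    DenseRange (toContinuousMapOnAlgHom (Icc (0 : ℝ) 1)).toLinearMap := by
  intro f
  rw [Metric.mem_closure_range_iff]
  intro ε hε
  obtain ⟨p, hp⟩ := exists_polynomial_near_continuousMap 0 1 f ε hε
  exact ⟨p, by rw [dist_comm, dist_eq_norm]; exact hp⟩

/-- The continuous functional calculus `f ↦ f(R)`, `f ∈ C[0, 1]`, of an operator `0 ≤ R ≤ 1`: the
continuous extension of `p ↦ p(R)` from the polynomials. For other `R` the extension need not exist,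
and the value carries no meaning. -/
def funCalc (R : H →L[ℝ] H) : C(Icc (0 : ℝ) 1, ℝ) →L[ℝ] (H →L[ℝ] H) :=
  (aeval R).toLinearMap.extendOfNorm (toContinuousMapOnAlgHom (Icc (0 : ℝ) 1)).toLinearMap

lemma IsEffect.norm_aeval_toLinearMap_le (hR : IsEffect R) (p : ℝ[X]) : ‖(aeval R).toLinearMap p‖ ≤
    1 * ‖(toContinuousMapOnAlgHom (Icc (0 : ℝ) 1)).toLinearMap p‖ := by
  rw [one_mul]; exact hR.norm_aeval_le p

lemma IsEffect.funCalc_poly (hR : IsEffect R) (p : ℝ[X]) :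
    funCalc R (p.toContinuousMapOn (Icc (0 : ℝ) 1)) = aeval R p := by
  have h := LinearMap.extendOfNorm_eq (f := (aeval R).toLinearMap)
    (e := (toContinuousMapOnAlgHom (Icc (0 : ℝ) 1)).toLinearMap) denseRange_toContinuousMapOn
    ⟨1, hR.norm_aeval_toLinearMap_le⟩ p
  rw [AlgHom.toLinearMap_apply, AlgHom.toLinearMap_apply, toContinuousMapOnAlgHom_apply] at h
  exact h

lemma IsEffect.norm_funCalc_le (hR : IsEffect R) (f : C(Icc (0 : ℝ) 1, ℝ)) :
    ‖funCalc R f‖ ≤ ‖f‖ := by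
  have := LinearMap.norm_extendOfNorm_apply_le (f := (aeval R).toLinearMap)
    (e := (toContinuousMapOnAlgHom (Icc (0 : ℝ) 1)).toLinearMap)
    denseRange_toContinuousMapOn 1 hR.norm_aeval_toLinearMap_le f
  rwa [one_mul] at this

/-- A closed property of continuous functions that holds for polynomials holds always. -/
lemma continuousMap_induction {P : C(Icc (0 : ℝ) 1, ℝ) → Prop} (hc : IsClosed {f | P f})
    (hp : ∀ p : ℝ[X], P (p.toContinuousMapOn (Icc (0 : ℝ) 1))) (f : C(Icc (0 : ℝ) 1, ℝ)) : P f :=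
  denseRange_toContinuousMapOn.induction_on f hc hp

lemma IsEffect.funCalc_mul (hR : IsEffect R) (f g : C(Icc (0 : ℝ) 1, ℝ)) :
    funCalc R (f * g) = funCalc R f * funCalc R g := by
  refine continuousMap_induction (P := fun f => funCalc R (f * g) = funCalc R f * funCalc R g)
    (isClosed_eq (by fun_prop) (by fun_prop)) (fun p => ?_) f
  refine continuousMap_induction
    (P := fun g => funCalc R (p.toContinuousMapOn _ * g) = funCalc R _ * funCalc R g)
    (isClosed_eq (by fun_prop) (by fun_prop)) (fun q => ?_) g
  rw [hR.funCalc_poly, hR.funCalc_poly, ← map_mul, ← hR.funCalc_poly]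
  congr 1
  exact (map_mul (toContinuousMapOnAlgHom (Icc (0 : ℝ) 1)) p q).symm

lemma IsEffect.inner_funCalc (hR : IsEffect R) (f : C(Icc (0 : ℝ) 1, ℝ)) (x y : H) :
    inner ℝ (funCalc R f x) y = inner ℝ x (funCalc R f y) := by
  refine continuousMap_induction
    (P := fun f => inner ℝ (funCalc R f x) y = inner ℝ x (funCalc R f y))
    (isClosed_eq (by fun_prop) (by fun_prop)) (fun p => ?_) f
  rw [hR.funCalc_poly]
  exact (hR.isSelfAdjoint_aeval p).isSymmetric x y

/-- The identity function on `[0, 1]`. -/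
def idFun : C(Icc (0 : ℝ) 1, ℝ) := ⟨fun r => r, by fun_prop⟩

lemma IsEffect.funCalc_id (hR : IsEffect R) : funCalc R idFun = R := by
  have : idFun = (X : ℝ[X]).toContinuousMapOn (Icc (0 : ℝ) 1) := by ext r; simp [idFun]
  rw [this, hR.funCalc_poly, aeval_X]

lemma IsEffect.funCalc_one (hR : IsEffect R) : funCalc R 1 = 1 := by
  have : (1 : C(Icc (0 : ℝ) 1, ℝ)) = (1 : ℝ[X]).toContinuousMapOn (Icc (0 : ℝ) 1) := by ext r; simp
  rw [this, hR.funCalc_poly, map_one]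

lemma IsEffect.apply_funCalc (hR : IsEffect R) (f : C(Icc (0 : ℝ) 1, ℝ)) (x : H) :
    R (funCalc R f x) = funCalc R (idFun * f) x := by
  rw [hR.funCalc_mul, hR.funCalc_id]; rfl

lemma IsEffect.funCalc_nonneg (hR : IsEffect R) {f : C(Icc (0 : ℝ) 1, ℝ)} (hf : 0 ≤ f) (x : H) :
    0 ≤ inner ℝ (funCalc R f x) x := by
  -- `f(R) = √f(R)²`
  let g : C(Icc (0 : ℝ) 1, ℝ) := ⟨fun r => √(f r), by fun_prop⟩
  have e : f = g * g := by ext r; exact (Real.mul_self_sqrt (hf r)).symm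
  rw [e, hR.funCalc_mul, mul_apply_eq_comp, hR.inner_funCalc]
  exact real_inner_self_nonneg

lemma IsEffect.funCalc_comm (hR : IsEffect R) {U : H →L[ℝ] H} (hU : ∀ x, R (U x) = U (R x))
    (f : C(Icc (0 : ℝ) 1, ℝ)) (x : H) : funCalc R f (U x) = U (funCalc R f x) := by
  refine continuousMap_induction (P := fun f => funCalc R f (U x) = U (funCalc R f x))
    (isClosed_eq (by fun_prop) (by fun_prop)) (fun p => ?_) f
  rw [hR.funCalc_poly]
  have hc : Commute R U := by ext x; exact hU x
  induction p using Polynomial.induction_on' with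
  | add p q hp hq => simp [hp, hq]
  | monomial n a =>
    have := congrArg (fun T : H →L[ℝ] H => T x) (hc.pow_left n).eq
    simp only [mul_apply_eq_comp] at this
    simp [aeval_monomial, Algebra.algebraMap_eq_smul_one, this]

end FunctionalCalculus

/-! ### The functions `r ↦ r⁻ᵐ exp(-t/r)` on `[0, 1]` -/

/-- `r ↦ r⁻ᵐ exp(-t/r)`, with the value `0` at `r ≤ 0`. -/
def expInv (t : ℝ) (m : ℕ) (r : ℝ) : ℝ := if r ≤ 0 then 0 else r⁻¹ ^ m * Real.exp (-(t * r⁻¹))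

lemma expInv_zero (t : ℝ) (m : ℕ) : expInv t m 0 = 0 := by simp [expInv]

lemma expInv_of_pos (t : ℝ) (m : ℕ) {r : ℝ} (hr : 0 < r) :
    expInv t m r = r⁻¹ ^ m * Real.exp (-(t * r⁻¹)) := by simp [expInv, hr]

lemma expInv_nonneg (t : ℝ) (m : ℕ) (r : ℝ) : 0 ≤ expInv t m r := by
  unfold expInv; split_ifs with h
  · rfl
  · have := not_le.mp h; positivity

/-- This is `xᵐ / m! ≤ exp x` for `x = t / r`. -/
lemma expInv_le {t : ℝ} (ht : 0 < t) (m : ℕ) (r : ℝ) : expInv t m r ≤ m.factorial / t ^ m := by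
  unfold expInv; split_ifs with h
  · positivity
  · have hr := not_le.mp h
    have := Real.pow_div_factorial_le_exp (x := t * r⁻¹) (by positivity) m
    rw [Real.exp_neg, ← div_eq_mul_inv, div_le_div_iff₀ (by positivity) (by positivity)]
    rw [div_le_iff₀ (by positivity), mul_pow] at this
    linarith

lemma mul_expInv_succ (t : ℝ) (m : ℕ) (r : ℝ) : r * expInv t (m + 1) r = expInv t m r := by
  unfold expInv; split_ifs with h
  · simp
  · have hr := not_le.mp h
    rw [pow_succ]; field_simp

lemma continuous_expInv {t : ℝ} (ht : 0 < t) (m : ℕ) : Continuous (expInv t m) := by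
  rw [continuous_iff_continuousAt]
  intro r
  rcases lt_trichotomy r 0 with hr | rfl | hr
  · refine (continuousAt_const (y := (0 : ℝ))).congr ?_
    filter_upwards [Iio_mem_nhds hr] with x hx
    simp [expInv, (mem_Iio.mp hx).le]
  · -- near `0` the function is `r` times the bounded function `expInv t (m + 1)`
    rw [ContinuousAt, expInv_zero]
    refine squeeze_zero_norm (a := fun r => |r| * ((m + 1).factorial / t ^ (m + 1)))
      (fun r => ?_) ?_
    · rw [← mul_expInv_succ, norm_mul, Real.norm_eq_abs, Real.norm_eq_abs,
        abs_of_nonneg (expInv_nonneg _ _ _)]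
      gcongr
      exact expInv_le ht _ _
    · have : Continuous fun r : ℝ => |r| * ((m + 1).factorial / t ^ (m + 1)) := by fun_prop
      simpa using this.tendsto 0
  · have : ContinuousAt (fun r : ℝ => r⁻¹ ^ m * Real.exp (-(t * r⁻¹))) r := by
      have := continuousAt_inv₀ hr.ne'
      fun_prop
    refine this.congr ?_
    filter_upwards [Ioi_mem_nhds hr] with x hx
    rw [expInv_of_pos _ _ hx]

/-- The function `r ↦ r⁻ᵐ exp(-t/r)` as an element of `C[0, 1]` for `t > 0`; zero for `t ≤ 0`. -/
def expFun (t : ℝ) (m : ℕ) : C(Icc (0 : ℝ) 1, ℝ) :=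
  if h : 0 < t then ⟨fun r => expInv t m r, (continuous_expInv h m).comp continuous_subtype_val⟩
  else 0

lemma expFun_apply {t : ℝ} (ht : 0 < t) (m : ℕ) (r : Icc (0 : ℝ) 1) :
    expFun t m r = expInv t m r := by simp [expFun, ht]

lemma norm_expFun_le {t : ℝ} (ht : 0 < t) (m : ℕ) : ‖expFun t m‖ ≤ m.factorial / t ^ m := by
  rw [ContinuousMap.norm_le _ (by positivity)]
  intro r
  rw [expFun_apply ht, Real.norm_eq_abs, abs_of_nonneg (expInv_nonneg _ _ _)]
  exact expInv_le ht _ _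

lemma idFun_mul_expFun {t : ℝ} (ht : 0 < t) (m : ℕ) :
    idFun * expFun t (m + 1) = expFun t m := by
  ext r
  rw [ContinuousMap.mul_apply, expFun_apply ht, expFun_apply ht]
  exact mul_expInv_succ _ _ _

lemma expFun_mul {t s : ℝ} (ht : 0 < t) (hs : 0 < s) (m n : ℕ) :
    expFun t m * expFun s n = expFun (t + s) (m + n) := by
  ext r
  rw [ContinuousMap.mul_apply, expFun_apply ht, expFun_apply hs, expFun_apply (by positivity)]
  unfold expInv; split_ifs with h
  · simp
  · rw [pow_add, add_mul, neg_add, Real.exp_add]; ring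

lemma expFun_anti {t s : ℝ} (ht : 0 < t) (hts : t ≤ s) (m : ℕ) : expFun s m ≤ expFun t m := by
  intro r
  change expFun s m r ≤ expFun t m r
  rw [expFun_apply ht, expFun_apply (ht.trans_le hts)]
  unfold expInv; split_ifs with h
  · rfl
  · have hr := not_le.mp h
    gcongr

/-- Second-order Taylor bound for `exp(-·)`. -/
lemma abs_exp_neg_taylor_le {a b c : ℝ} (hca : c ≤ a) (hcb : c ≤ b) :
    |Real.exp (-a) - Real.exp (-b) + (a - b) * Real.exp (-b)| ≤ (a - b) ^ 2 * Real.exp (-c) := by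
  have tangent : ∀ x y : ℝ, (x - y) * Real.exp (-x) ≤ Real.exp (-y) - Real.exp (-x) := fun x y => by
    have := Real.add_one_le_exp (x - y)
    have h2 : Real.exp (-y) = Real.exp (x - y) * Real.exp (-x) := by
      rw [← Real.exp_add]; congr 1; ring
    rw [h2]
    nlinarith [Real.exp_pos (-x)]
  have h1 := tangent a b
  have h2 := tangent b a
  have ha : Real.exp (-a) ≤ Real.exp (-c) := Real.exp_le_exp.mpr (by linarith)
  have hb : Real.exp (-b) ≤ Real.exp (-c) := Real.exp_le_exp.mpr (by linarith)
  rw [abs_of_nonneg (by linarith)]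
  rcases le_total a b with h | h
  · nlinarith [mul_le_mul_of_nonneg_left ha (sq_nonneg (a - b)),
      mul_le_mul_of_nonneg_left h2 (sub_nonneg.mpr h),
      mul_le_mul_of_nonneg_left h1 (sub_nonneg.mpr h)]
  · nlinarith [mul_le_mul_of_nonneg_left hb (sq_nonneg (a - b)),
      mul_le_mul_of_nonneg_left h2 (sub_nonneg.mpr h),
      mul_le_mul_of_nonneg_left h1 (sub_nonneg.mpr h)]

/-- Differentiability in the supremum norm: the remainder is uniformly quadratic in `s - t`, because
`expInv (t / 2) (m + 2)` is bounded. -/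
lemma hasDerivAt_expFun {t : ℝ} (ht : 0 < t) (m : ℕ) :
    HasDerivAt (fun t => expFun t m) (-expFun t (m + 1)) t := by
  rw [hasDerivAt_iff_isLittleO]
  set C : ℝ := (m + 2).factorial / (t / 2) ^ (m + 2) with hC
  have hO : (fun s => expFun s m - expFun t m - (s - t) • -expFun t (m + 1)) =O[𝓝 t]
      fun s => (s - t) ^ 2 := by
    refine Asymptotics.IsBigO.of_bound C ?_
    filter_upwards [Ioi_mem_nhds (half_lt_self ht)] with s hs
    have hs' : t / 2 < s := hs
    have hs0 : 0 < s := (half_pos ht).trans hs'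
    rw [ContinuousMap.norm_le _ (by positivity)]
    intro r
    have e : (expFun s m - expFun t m - (s - t) • -expFun t (m + 1)) r =
        expInv s m r - expInv t m r + (s - t) * expInv t (m + 1) r := by
      simp [expFun_apply hs0, expFun_apply ht]
    rw [e]
    have hle := expInv_le (half_pos ht) (m + 2) r
    rcases r.2.1.eq_or_lt with h0 | h0
    · rw [← h0]; simp only [expInv_zero]; simp; positivity
    · have key := abs_exp_neg_taylor_le (a := s * (r : ℝ)⁻¹) (b := t * (r : ℝ)⁻¹)
        (c := t / 2 * (r : ℝ)⁻¹) (by gcongr) (by gcongr; linarith)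
      rw [expInv_of_pos _ _ h0] at hle
      rw [expInv_of_pos _ _ h0, expInv_of_pos _ _ h0, expInv_of_pos _ _ h0]
      have e2 : (r : ℝ)⁻¹ ^ m * Real.exp (-(s * (r : ℝ)⁻¹)) -
          (r : ℝ)⁻¹ ^ m * Real.exp (-(t * (r : ℝ)⁻¹)) +
          (s - t) * ((r : ℝ)⁻¹ ^ (m + 1) * Real.exp (-(t * (r : ℝ)⁻¹))) =
          (r : ℝ)⁻¹ ^ m * (Real.exp (-(s * (r : ℝ)⁻¹)) - Real.exp (-(t * (r : ℝ)⁻¹)) +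
            (s * (r : ℝ)⁻¹ - t * (r : ℝ)⁻¹) * Real.exp (-(t * (r : ℝ)⁻¹))) := by ring
      rw [e2, norm_mul, Real.norm_eq_abs, Real.norm_eq_abs,
        abs_of_pos (pow_pos (inv_pos.mpr h0) m), Real.norm_eq_abs,
        abs_of_nonneg (sq_nonneg (s - t))]
      calc _ ≤ (r : ℝ)⁻¹ ^ m * ((s * (r : ℝ)⁻¹ - t * (r : ℝ)⁻¹) ^ 2 *
            Real.exp (-(t / 2 * (r : ℝ)⁻¹))) := by gcongr
        _ = ((r : ℝ)⁻¹ ^ (m + 2) * Real.exp (-(t / 2 * (r : ℝ)⁻¹))) * (s - t) ^ 2 := by ring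
        _ ≤ _ := by gcongr
  refine hO.trans_isLittleO ?_
  have := (Asymptotics.isLittleO_pow_sub_sub t (one_lt_two))
  simpa using this

/-- This is `r (exp(-t/r) - 1)² ≤ t`, which controls the distance of `exp(-tΛ) h` from `h` in the
norm of `V*`. -/
lemma norm_idFun_mul_sq_le {t : ℝ} (ht : 0 < t) :
    ‖idFun * (expFun t 0 - 1) ^ 2‖ ≤ t := by
  rw [ContinuousMap.norm_le _ ht.le]
  intro r
  have e : (idFun * (expFun t 0 - 1) ^ 2 : C(Icc (0 : ℝ) 1, ℝ)) r = r * (expInv t 0 r - 1) ^ 2 := by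
    simp [expFun_apply ht, idFun]
  rw [e, Real.norm_eq_abs, abs_of_nonneg (mul_nonneg r.2.1 (sq_nonneg _))]
  rcases r.2.1.eq_or_lt with h0 | h0
  · rw [← h0]; simpa using ht.le
  · rw [expInv_of_pos _ _ h0, pow_zero, one_mul]
    have h1 := Real.add_one_le_exp (-(t * (r : ℝ)⁻¹))
    have h2 := Real.exp_pos (-(t * (r : ℝ)⁻¹))
    have h3 : Real.exp (-(t * (r : ℝ)⁻¹)) ≤ 1 := Real.exp_le_one_iff.mpr (by
      have : 0 < t * (r : ℝ)⁻¹ := by positivity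
      linarith)
    have h4 : (Real.exp (-(t * (r : ℝ)⁻¹)) - 1) ^ 2 ≤ t * (r : ℝ)⁻¹ := by nlinarith
    calc (r : ℝ) * (Real.exp (-(t * (r : ℝ)⁻¹)) - 1) ^ 2 ≤ r * (t * (r : ℝ)⁻¹) := by gcongr
      _ = t := by field_simp

/-! ### The semigroup of a coercive symmetric form -/

/-- A bounded symmetric coercive form `b(v, w) = ⟪B v, w⟫` on a Hilbert space `V` which is mapped
into a Hilbert space `H` by an injective contraction `j`. The operator of the form is written `Λ`,
and the form is normalized by `b(v, v) ≥ ‖v‖²`. -/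
structure FormTriple (V H : Type*) [NormedAddCommGroup V] [InnerProductSpace ℝ V]
    [NormedAddCommGroup H] [InnerProductSpace ℝ H] where
  j : V →L[ℝ] H
  B : V ≃L[ℝ] V
  j_injective : Function.Injective j
  norm_j_le : ∀ v, ‖j v‖ ≤ ‖v‖
  symm : ∀ v w, inner ℝ (B v) w = inner ℝ (B w) v
  coercive : ∀ v, ‖v‖ ^ 2 ≤ inner ℝ (B v) v

namespace FormTriple

variable {V H : Type*} [NormedAddCommGroup V] [InnerProductSpace ℝ V]
  [NormedAddCommGroup H] [InnerProductSpace ℝ H] (P : FormTriple V H)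

/-- The embedding `H → V*`, `h ↦ ⟪h, j ·⟫`. -/
def ofH : H →L[ℝ] StrongDual ℝ V :=
  (ContinuousLinearMap.precomp ℝ P.j).comp (innerSL ℝ)

@[simp] lemma ofH_apply (h : H) (w : V) : P.ofH h w = inner ℝ h (P.j w) := rfl

/-- The form as the operator `Λ : V → V*`, a map without bundled linearity. -/
def form (v : V) : StrongDual ℝ V := innerSL ℝ (P.B v)

@[simp] lemma form_apply (v w : V) : P.form v w = inner ℝ (P.B v) w := rfl

variable [CompleteSpace V]

/-- The inverse `Λ⁻¹ : V* → V` of the form. -/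
def solve : StrongDual ℝ V →L[ℝ] V :=
  P.B.symm.toContinuousLinearMap.comp
    (InnerProductSpace.toDual ℝ V).symm.toContinuousLinearEquiv.toContinuousLinearMap

lemma inner_B_solve (ℓ : StrongDual ℝ V) (w : V) : inner ℝ (P.B (P.solve ℓ)) w = ℓ w := by
  simp [solve]

/-- The solution operator `H → V` of `b(E h, w) = ⟪h, j w⟫`. -/
def E : H →L[ℝ] V := P.solve.comp P.ofH

lemma inner_B_E (h : H) (w : V) : inner ℝ (P.B (P.E h)) w = inner ℝ h (P.j w) :=
  P.inner_B_solve _ _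

/-- The resolvent `Λ⁻¹ : H → H`. -/
def R : H →L[ℝ] H := P.j.comp P.E

lemma R_apply (h : H) : P.R h = P.j (P.E h) := rfl

lemma norm_E_sq_le (h : H) : ‖P.E h‖ ^ 2 ≤ inner ℝ (P.R h) h := by
  refine (P.coercive _).trans_eq ?_
  rw [inner_B_E, real_inner_comm]; rfl

lemma norm_E_le (h : H) : ‖P.E h‖ ≤ ‖h‖ := by
  have h1 := P.norm_E_sq_le h
  have h2 := real_inner_le_norm (P.R h) h
  have h3 := P.norm_j_le (P.E h)
  rw [R_apply] at h1 h2
  by_contra! hlt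
  nlinarith [norm_nonneg (P.E h), norm_nonneg h, mul_le_mul_of_nonneg_right h3 (norm_nonneg h)]

/-- The norm of `V*` is controlled by `Λ⁻¹`. -/
lemma norm_ofH_le (h : H) : ‖P.ofH h‖ ≤ ‖P.B.toContinuousLinearMap‖ * ‖P.E h‖ := by
  refine ContinuousLinearMap.opNorm_le_bound _ (by positivity) fun w => ?_
  rw [ofH_apply, ← inner_B_E]
  refine (norm_inner_le_norm _ _).trans ?_
  gcongr
  exact P.B.toContinuousLinearMap.le_opNorm _

variable [CompleteSpace H]

lemma isEffect_R : IsEffect P.R where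
  selfAdjoint := by
    rw [ContinuousLinearMap.isSelfAdjoint_iff_isSymmetric]
    intro x y
    change inner ℝ (P.j (P.E x)) y = inner ℝ x (P.j (P.E y))
    rw [← inner_B_E, P.symm, inner_B_E, real_inner_comm]
  nonneg x := (sq_nonneg _).trans (P.norm_E_sq_le x)
  le_one x := by
    refine (real_inner_le_norm _ _).trans ?_
    have := (P.norm_j_le (P.E x)).trans (P.norm_E_le x)
    rw [sq]; exact mul_le_mul_of_nonneg_right this (norm_nonneg _)

/-- The operator function `r⁻ᵐ exp(-t/r)` of the resolvent, i.e. `Λᵐ exp(-tΛ)` with `Λ = R⁻¹`. -/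
def heat (t : ℝ) (m : ℕ) : H →L[ℝ] H := funCalc P.R (expFun t m)

lemma R_heat {t : ℝ} (ht : 0 < t) (m : ℕ) (h : H) : P.R (P.heat t (m + 1) h) = P.heat t m h := by
  rw [heat, P.isEffect_R.apply_funCalc, idFun_mul_expFun ht]; rfl

lemma inner_heat (t : ℝ) (m : ℕ) (x y : H) :
    inner ℝ (P.heat t m x) y = inner ℝ x (P.heat t m y) := P.isEffect_R.inner_funCalc _ _ _

lemma norm_heat_le {t : ℝ} (ht : 0 < t) (m : ℕ) (h : H) :
    ‖P.heat t m h‖ ≤ m.factorial / t ^ m * ‖h‖ :=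
  (ContinuousLinearMap.le_opNorm _ _).trans (mul_le_mul_of_nonneg_right
    ((P.isEffect_R.norm_funCalc_le _).trans (norm_expFun_le ht m)) (norm_nonneg _))

lemma hasDerivAt_heat {t : ℝ} (ht : 0 < t) (m : ℕ) (h : H) :
    HasDerivAt (fun t => P.heat t m h) (-P.heat t (m + 1) h) t := by
  have := (funCalc P.R).hasFDerivAt.comp_hasDerivAt t (hasDerivAt_expFun ht m)
  have := (ContinuousLinearMap.apply ℝ H h).hasFDerivAt.comp_hasDerivAt t this
  simpa [heat, Function.comp_def] using this

/-- The semigroup `exp(-tΛ)` on `V`, written as `Λ⁻¹ Λ exp(-tΛ)` so that the value lies in `V`; the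
identity for `t ≤ 0`. -/
def semigroup (t : ℝ) (v : V) : V := if 0 < t then P.E (P.heat t 1 (P.j v)) else v

lemma semigroup_of_pos {t : ℝ} (ht : 0 < t) (v : V) :
    P.semigroup t v = P.E (P.heat t 1 (P.j v)) := by simp [semigroup, ht]

lemma semigroup_of_nonpos {t : ℝ} (ht : t ≤ 0) (v : V) : P.semigroup t v = v := by
  simp [semigroup, ht]

lemma j_semigroup {t : ℝ} (ht : 0 < t) (v : V) :
    P.j (P.semigroup t v) = P.heat t 0 (P.j v) := by
  rw [semigroup_of_pos P ht, ← R_apply, P.R_heat ht]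

lemma inner_B_semigroup {t : ℝ} (ht : 0 < t) (v w : V) :
    inner ℝ (P.B (P.semigroup t v)) w = inner ℝ (P.heat t 1 (P.j v)) (P.j w) := by
  rw [semigroup_of_pos P ht, inner_B_E]

lemma inner_B_semigroup_comm (t : ℝ) (v w : V) :
    inner ℝ (P.B (P.semigroup t v)) w = inner ℝ (P.B (P.semigroup t w)) v := by
  rcases lt_or_ge 0 t with ht | ht
  · rw [inner_B_semigroup P ht, inner_B_semigroup P ht, inner_heat, real_inner_comm]
  · rw [semigroup_of_nonpos P ht, semigroup_of_nonpos P ht, P.symm]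

/-- The semigroup is bounded on `V`. With
`G(t) = ⟪Λ exp(-tΛ) v, v⟫ = b(exp(-tΛ) v, v)`, which is nonincreasing, positivity of
`b(exp(-tΛ) v - v, exp(-tΛ) v - v) = G(2t) - 2 G(t) + b(v, v)` gives `G(t) ≤ b(v, v)`. -/
lemma norm_semigroup_sq_le (t : ℝ) (v : V) :
    ‖P.semigroup t v‖ ^ 2 ≤ inner ℝ (P.B v) v := by
  rcases lt_or_ge 0 t with ht | ht
  swap
  · rw [semigroup_of_nonpos P ht]; exact P.coercive v
  refine (P.coercive _).trans ?_
  set w := P.semigroup t v with hw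
  have e1 : inner ℝ (P.B w) v = inner ℝ (P.heat t 1 (P.j v)) (P.j v) := inner_B_semigroup P ht _ _
  have e2 : inner ℝ (P.B w) w = inner ℝ (P.heat (t + t) 1 (P.j v)) (P.j v) := by
    rw [hw, inner_B_semigroup P ht, j_semigroup P ht, ← inner_heat, heat, heat, heat,
      ← expFun_mul ht ht 0 1, P.isEffect_R.funCalc_mul]
    rfl
  have e3 : inner ℝ (P.B w) w ≤ inner ℝ (P.B w) v := by
    rw [e1, e2, ← sub_nonneg, ← inner_sub_left, heat, heat, ← sub_apply, ← map_sub]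
    exact P.isEffect_R.funCalc_nonneg (sub_nonneg.mpr (expFun_anti ht (by linarith) 1)) _
  have e4 := (sq_nonneg _).trans (P.coercive (w - v))
  simp only [map_sub, inner_sub_left, inner_sub_right] at e4
  rw [P.symm v w] at e4
  linarith

/-- The semigroup is continuous at `t = 0` as a map into `V*`. -/
lemma norm_ofH_semigroup_sub_le {t : ℝ} (ht : 0 < t) (v : V) :
    ‖P.ofH (P.j (P.semigroup t v)) - P.ofH (P.j v)‖ ≤
      ‖P.B.toContinuousLinearMap‖ * √(t * ‖P.j v‖ ^ 2) := by
  rw [← map_sub]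
  refine (P.norm_ofH_le _).trans ?_
  gcongr
  refine Real.le_sqrt_of_sq_le ((P.norm_E_sq_le _).trans ?_)
  have hE := P.isEffect_R
  have e : P.j (P.semigroup t v) - P.j v = funCalc P.R (expFun t 0 - 1) (P.j v) := by
    rw [j_semigroup P ht, map_sub, hE.funCalc_one]; rfl
  rw [e, hE.apply_funCalc, hE.inner_funCalc, ← mul_apply_eq_comp, ← hE.funCalc_mul]
  refine (real_inner_le_norm _ _).trans ?_
  rw [sq, mul_comm, ← mul_assoc]
  refine mul_le_mul_of_nonneg_right ?_ (norm_nonneg _)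
  refine (ContinuousLinearMap.le_opNorm _ _).trans ?_
  refine mul_le_mul_of_nonneg_right ((hE.norm_funCalc_le _).trans ?_) (norm_nonneg _)
  refine le_trans (le_of_eq ?_) (norm_idFun_mul_sq_le ht)
  congr 1; ring

lemma hasDerivAt_ofH_semigroup {t : ℝ} (ht : 0 < t) (v : V) :
    HasDerivAt (fun t => P.ofH (P.j (P.semigroup t v))) (-P.form (P.semigroup t v)) t := by
  have h1 := P.ofH.hasFDerivAt.comp_hasDerivAt t (P.hasDerivAt_heat ht 0 (P.j v))
  have e : -P.form (P.semigroup t v) = P.ofH (-P.heat t (0 + 1) (P.j v)) := by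
    ext w
    simp [inner_B_semigroup P ht]
  rw [e]
  refine h1.congr_of_eventuallyEq ?_
  filter_upwards [Ioi_mem_nhds ht] with s hs
  rw [j_semigroup P hs]; rfl

/-- The derivative `-Λ exp(-tΛ) v` is bounded in `V*`, since `exp(-tΛ) v` is bounded in `V`. -/
lemma exists_lipschitz_semigroup (v : V) :
    ∃ K, LipschitzWith K fun t => P.ofH (P.j (P.semigroup t v)) := by
  set f := fun t => P.ofH (P.j (P.semigroup t v)) with hf
  set C : ℝ := ‖P.B.toContinuousLinearMap‖ * √(inner ℝ (P.B v) v) with hC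
  have hC0 : 0 ≤ C := by positivity
  have h1 : LipschitzOnWith C.toNNReal f (Ioi 0) := by
    refine (convex_Ioi (0 : ℝ)).lipschitzOnWith_of_nnnorm_hasDerivWithin_le
      (fun t ht => (P.hasDerivAt_ofH_semigroup ht v).hasDerivWithinAt) fun t _ => ?_
    rw [← NNReal.coe_le_coe, Real.coe_toNNReal C hC0]
    change ‖-P.form (P.semigroup t v)‖ ≤ C
    rw [norm_neg, form, innerSL_apply_norm]
    refine (P.B.toContinuousLinearMap.le_opNorm _).trans ?_
    rw [hC]
    gcongr
    exact Real.le_sqrt_of_sq_le (P.norm_semigroup_sq_le t v)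
  have hcont : ContinuousOn f (Ici 0) := by
    intro t ht
    rcases (mem_Ici.mp ht).eq_or_lt with h0 | h0
    · subst h0
      have : Tendsto (fun t => ‖f t - f 0‖) (𝓝[Ici 0] 0) (𝓝 0) := by
        have hb : Tendsto (fun t : ℝ => ‖P.B.toContinuousLinearMap‖ * √(t * ‖P.j v‖ ^ 2))
            (𝓝[Ici 0] 0) (𝓝 0) := by
          have : Continuous fun t : ℝ => ‖P.B.toContinuousLinearMap‖ * √(t * ‖P.j v‖ ^ 2) := by
            fun_prop
          simpa using (this.tendsto 0).mono_left nhdsWithin_le_nhds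
        refine squeeze_zero' (Eventually.of_forall fun t => norm_nonneg _) ?_ hb
        filter_upwards [self_mem_nhdsWithin] with t ht
        rcases (mem_Ici.mp ht).eq_or_lt with h0 | h0
        · rw [← h0]; simp
        · have := P.norm_ofH_semigroup_sub_le h0 v
          simpa only [hf, P.semigroup_of_nonpos le_rfl] using this
      exact tendsto_iff_norm_sub_tendsto_zero.mpr this
    · exact (P.hasDerivAt_ofH_semigroup h0 v).continuousAt.continuousWithinAt
  have h2 : LipschitzOnWith C.toNNReal f (Ici 0) := by
    rw [← closure_Ioi]
    exact LipschitzOnWith.closure (by rwa [closure_Ioi]) h1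
  -- `f` is constant on `(-∞, 0]`
  have h3 : ∀ t, f t = f (max t 0) := fun t => by
    rcases le_total t 0 with h | h
    · simp only [hf]
      rw [max_eq_right h, P.semigroup_of_nonpos h, P.semigroup_of_nonpos le_rfl]
    · rw [max_eq_left h]
  refine ⟨C.toNNReal, LipschitzWith.of_dist_le_mul fun s t => ?_⟩
  rw [h3 s, h3 t]
  refine (h2.dist_le_mul _ (le_max_right s 0) _ (le_max_right t 0)).trans ?_
  gcongr
  exact abs_max_sub_max_le_abs s t 0

end FormTriple

/-! ### Uniqueness for the evolution equation of the form -/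

lemma absolutelyContinuousOnInterval_of_dist_le {X Y : Type*} [PseudoMetricSpace X]
    [PseudoMetricSpace Y] {f : ℝ → X} {g : ℝ → Y} {a b C : ℝ}
    (hf : AbsolutelyContinuousOnInterval f a b)
    (h : ∀ x ∈ uIcc a b, ∀ y ∈ uIcc a b, dist (g x) (g y) ≤ C * dist (f x) (f y)) :
    AbsolutelyContinuousOnInterval g a b := by
  unfold AbsolutelyContinuousOnInterval at hf ⊢
  refine squeeze_zero' (Eventually.of_forall fun _ => Finset.sum_nonneg fun i _ => dist_nonneg) ?_
    (by simpa using hf.const_mul C)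
  rw [eventually_inf_principal]
  filter_upwards with I hI
  rw [Finset.mul_sum]
  exact Finset.sum_le_sum fun i hi => h _ (hI.1 i hi).1 _ (hI.1 i hi).2

lemma _root_.LipschitzWith.absolutelyContinuousOnInterval {X : Type*} [PseudoMetricSpace X]
    {f : ℝ → X} {K : NNReal} (hf : LipschitzWith K f) (a b : ℝ) :
    AbsolutelyContinuousOnInterval f a b :=
  (hf.lipschitzOnWith (s := uIcc a b)).absolutelyContinuousOnInterval

/-- Grönwall's inequality for absolutely continuous functions. -/
lemma nonpos_of_ae_deriv_le {N N' : ℝ → ℝ} {T c : ℝ}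
    (hN : AbsolutelyContinuousOnInterval N 0 T) (h0 : N 0 = 0)
    (hd : ∀ᵐ t, t ∈ Ioo 0 T → HasDerivAt N (N' t) t ∧ N' t ≤ c * N t) {t : ℝ}
    (ht : t ∈ Icc 0 T) : N t ≤ 0 := by
  set M : ℝ → ℝ := fun s => Real.exp (-(c * s)) * N s with hM
  have hMac : AbsolutelyContinuousOnInterval M 0 t :=
    (ContDiffOn.absolutelyContinuousOnInterval (f := fun s : ℝ => Real.exp (-(c * s)))
      (by fun_prop)).mul (hN.mono (uIcc_subset_uIcc left_mem_uIcc
        (by rwa [uIcc_of_le (ht.1.trans ht.2)])))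
  have hint := hMac.integral_deriv_eq_sub
  have hle : 0 ≤ ∫ s in (0 : ℝ)..t, -deriv M s := by
    refine intervalIntegral.integral_nonneg_of_ae_restrict ht.1 ?_
    rw [← Measure.restrict_congr_set Ioo_ae_eq_Icc, EventuallyLE,
      ae_restrict_iff' measurableSet_Ioo]
    filter_upwards [hd] with s hs hst
    obtain ⟨h1, h2⟩ := hs ⟨hst.1, hst.2.trans_le ht.2⟩
    have h3 : HasDerivAt (fun s : ℝ => Real.exp (-(c * s))) (Real.exp (-(c * s)) * -(c * 1)) s :=
      ((hasDerivAt_id s).const_mul c).neg.exp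
    have h4 : HasDerivAt M _ s := h3.mul h1
    rw [h4.deriv, Pi.zero_apply]
    nlinarith [mul_le_mul_of_nonneg_left h2 (Real.exp_pos (-(c * s))).le]
  rw [intervalIntegral.integral_neg, hint, neg_nonneg] at hle
  have : Real.exp (-(c * t)) * N t ≤ 0 := by simpa [hM, h0] using hle
  exact nonpos_of_mul_nonpos_right this (Real.exp_pos _)

namespace FormTriple

variable {V H : Type*} [NormedAddCommGroup V] [InnerProductSpace ℝ V]
  [NormedAddCommGroup H] [InnerProductSpace ℝ H] (P : FormTriple V H)

lemma ofH_j_injective {v : V} (h : P.ofH (P.j v) = 0) : v = 0 := by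
  have := congrArg (fun ℓ => ℓ v) h
  simp only [ofH_apply, zero_apply, inner_self_eq_zero] at this
  exact (injective_iff_map_eq_zero P.j).mp P.j_injective v this

variable [CompleteSpace V]

lemma solve_symm (ℓ ℓ' : StrongDual ℝ V) : ℓ (P.solve ℓ') = ℓ' (P.solve ℓ) := by
  rw [← P.inner_B_solve, P.symm, inner_B_solve]

/-- Uniqueness for `W' = -Λ W + c W` in `V*`: the function `N = b(g, g)`, `g = Λ⁻¹ W`, satisfies
`N' = -2 ‖W‖² + 2 c N`. -/
lemma eq_zero_of_evolution {W : ℝ → V} {T c : ℝ} (h0 : W 0 = 0)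
    (hac : AbsolutelyContinuousOnInterval (fun t => P.ofH (P.j (W t))) 0 T)
    (hd : ∀ᵐ t, t ∈ Ioo 0 T → HasDerivAt (fun t => P.ofH (P.j (W t)))
      (-P.form (W t) + c • P.ofH (P.j (W t))) t) {t : ℝ} (ht : t ∈ Icc 0 T) : W t = 0 := by
  set g : ℝ → V := fun t => P.solve (P.ofH (P.j (W t))) with hg
  set N : ℝ → ℝ := fun t => inner ℝ (P.B (g t)) (g t) with hN
  have hgac : AbsolutelyContinuousOnInterval g 0 T :=
    absolutelyContinuousOnInterval_of_dist_le (C := ‖P.solve‖) hac fun x _ y _ => by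
      rw [dist_eq_norm, dist_eq_norm, ← map_sub]
      exact P.solve.le_opNorm _
  obtain ⟨C, hC⟩ := hgac.exists_bound
  have hNac : AbsolutelyContinuousOnInterval N 0 T := by
    refine absolutelyContinuousOnInterval_of_dist_le (C := ‖P.B.toContinuousLinearMap‖ * (2 * C))
      hgac fun x hx y hy => ?_
    have e : N x - N y = inner ℝ (P.B (g x - g y)) (g x + g y) := by
      simp only [hN, map_sub, inner_sub_left, inner_add_right, P.symm (g x) (g y)]
      ring
    rw [dist_eq_norm, dist_eq_norm, e]
    refine (norm_inner_le_norm _ _).trans ?_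
    have h1 : ‖P.B (g x - g y)‖ ≤ ‖P.B.toContinuousLinearMap‖ * ‖g x - g y‖ :=
      P.B.toContinuousLinearMap.le_opNorm _
    have h2 : ‖g x + g y‖ ≤ 2 * C := (norm_add_le _ _).trans (by linarith [hC x hx, hC y hy])
    calc _ ≤ (‖P.B.toContinuousLinearMap‖ * ‖g x - g y‖) * (2 * C) := by gcongr
      _ = _ := by ring
  have hN0 : N 0 = 0 := by simp [hN, hg, h0]
  have key : N t ≤ 0 := by
    refine nonpos_of_ae_deriv_le (N' := fun t => -2 * ‖P.j (W t)‖ ^ 2 + 2 * c * N t)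
      (c := 2 * c) hNac hN0 ?_ ht
    filter_upwards [hd] with s hs hsT
    refine ⟨?_, by nlinarith [sq_nonneg ‖P.j (W s)‖]⟩
    have h1 := P.solve.hasFDerivAt.comp_hasDerivAt s (hs hsT)
    have h2 := P.B.toContinuousLinearMap.hasFDerivAt.comp_hasDerivAt s h1
    have h3 := h2.inner ℝ h1
    convert! h3 using 1
    simp only [Function.comp_apply, ContinuousLinearEquiv.coe_coe, inner_B_solve]
    rw [P.solve_symm]
    simp only [add_apply, neg_apply, smul_apply, form_apply, ofH_apply, smul_eq_mul]
    have e1 : inner ℝ (P.B (W s)) (P.solve (P.ofH (P.j (W s)))) = ‖P.j (W s)‖ ^ 2 := by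
      rw [P.symm, inner_B_solve, ofH_apply, real_inner_self_eq_norm_sq]
    have e2 : N s = inner ℝ (P.j (W s)) (P.j (P.solve (P.ofH (P.j (W s))))) := by
      simp only [hN, hg]
      rw [inner_B_solve, ofH_apply]
    rw [e1, e2]
    ring
  have hg0 : g t = 0 := by
    have := (P.coercive (g t)).trans key
    exact norm_eq_zero.mp (by nlinarith [norm_nonneg (g t)])
  refine P.ofH_j_injective ?_
  ext w
  rw [← P.inner_B_solve]
  change inner ℝ (P.B (g t)) w = _
  simp [hg0]

/-! ### States that are not reached from the origin -/

variable [CompleteSpace H]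

/-- The states `Λⁿ⁺¹ exp(-tΛ) v ∈ V`; only `t > 0` is meaningful. -/
def orbit (t : ℝ) (v : V) (n : ℕ) : V := P.E (P.heat t (n + 2) (P.j v))

lemma inner_B_orbit {t : ℝ} (ht : 0 < t) (v : V) (n : ℕ) (w : V) :
    inner ℝ (P.B (P.orbit t v n)) w = inner ℝ (P.j (P.orbit t v (n + 1))) (P.j w) := by
  rw [orbit, inner_B_E, orbit, ← R_apply, P.R_heat ht]

lemma norm_orbit_le {t : ℝ} (ht : 0 < t) (v : V) (n : ℕ) :
    ‖P.orbit t v n‖ ≤ (n + 2).factorial / t ^ (n + 2) * ‖P.j v‖ :=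
  (P.norm_E_le _).trans (P.norm_heat_le ht _ _)

lemma semigroup_eq_zero_of_orbit {t : ℝ} (ht : 0 < t) (v : V) (h : P.orbit t v 0 = 0) :
    P.semigroup t v = 0 := by
  rw [semigroup_of_pos P ht, ← P.R_heat ht, R_apply]
  change P.E (P.j (P.orbit t v 0)) = 0
  simp [h]

lemma eq_zero_of_semigroup {T : ℝ} (hT : 0 < T) (v : V)
    (h : ∀ t ∈ Ioo 0 T, P.semigroup t v = 0) : v = 0 := by
  obtain ⟨K, hK⟩ := P.exists_lipschitz_semigroup v
  have h1 : Tendsto (fun t => P.ofH (P.j (P.semigroup t v))) (𝓝[>] 0)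
      (𝓝 (P.ofH (P.j (P.semigroup 0 v)))) := (hK.continuous.tendsto 0).mono_left nhdsWithin_le_nhds
  have h2 : Tendsto (fun t => P.ofH (P.j (P.semigroup t v))) (𝓝[>] 0) (𝓝 0) := by
    refine tendsto_const_nhds.congr' ?_
    filter_upwards [Ioo_mem_nhdsGT hT] with t ht
    simp [h t ht]
  have := tendsto_nhds_unique h1 h2
  rw [P.semigroup_of_nonpos le_rfl] at this
  exact P.ofH_j_injective this

/-- If `y` is `b`-orthogonal to `p - exp(-tΛ) p`, `p = Λ⁻¹ ℓ`, for `0 < t < T`, then `ℓ` vanishes on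
the orbit `Λⁿ⁺¹ exp(-tΛ) y`. -/
lemma apply_orbit_eq_zero (ℓ : StrongDual ℝ V) {T : ℝ} (y : V)
    (h : ∀ t ∈ Ioo 0 T, inner ℝ (P.B y) (P.solve ℓ - P.semigroup t (P.solve ℓ)) = 0)
    (n : ℕ) : ∀ t ∈ Ioo 0 T, ℓ (P.orbit t y n) = 0 := by
  have hder : ∀ m, ∀ t ∈ Ioo 0 T, HasDerivAt (fun t => ℓ (P.E (P.heat t m (P.j y))))
      (-ℓ (P.E (P.heat t (m + 1) (P.j y)))) t := fun m t ht => by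
    have := (ℓ.comp P.E).hasFDerivAt.comp_hasDerivAt t (P.hasDerivAt_heat ht.1 m (P.j y))
    simpa [Function.comp_def] using! this
  have hconst : ∀ m (c : ℝ), (∀ t ∈ Ioo 0 T, ℓ (P.E (P.heat t m (P.j y))) = c) →
      ∀ t ∈ Ioo 0 T, ℓ (P.E (P.heat t (m + 1) (P.j y))) = 0 := fun m c hc t ht => by
    have h1 : HasDerivAt (fun t => ℓ (P.E (P.heat t m (P.j y)))) 0 t := by
      refine (hasDerivAt_const t c).congr_of_eventuallyEq ?_
      filter_upwards [Ioo_mem_nhds ht.1 ht.2] with s hs using hc s hs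
    exact neg_eq_zero.mp ((hder m t ht).unique h1)
  induction n with
  | zero =>
    refine hconst 1 (inner ℝ (P.B y) (P.solve ℓ)) fun t ht => ?_
    have := h t ht
    rw [inner_sub_right, sub_eq_zero, P.symm y (P.semigroup t _), P.inner_B_semigroup_comm,
      P.symm (P.semigroup t y), P.inner_B_solve, P.semigroup_of_pos ht.1] at this
    exact this.symm
  | succ n ih => exact hconst (n + 2) 0 ih

end FormTriple

/-! ### Unique continuation from a point -/

/-- One integration with respect to `dσ = s dx` raises the order of a bound `c σᵏ / k!` by one. -/
lemma abs_le_of_abs_deriv_le_pow {f f' s σ : ℝ → ℝ} {X c : ℝ} {k : ℕ} (h0 : f 0 = 0)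
    (hf : ∀ x, HasDerivAt f (f' x) x) (hσ : ∀ x, HasDerivAt σ (s x) x) (hσ0 : σ 0 = 0)
    (hb : ∀ x ∈ Icc 0 X, |f' x| ≤ s x * (c * (σ x ^ k / k.factorial))) :
    ∀ x ∈ Icc 0 X, |f x| ≤ c * (σ x ^ (k + 1) / (k + 1).factorial) := by
  refine image_norm_le_of_norm_deriv_right_le_deriv_boundary
    (B := fun x => c * (σ x ^ (k + 1) / (k + 1).factorial))
    (B' := fun x => s x * (c * (σ x ^ k / k.factorial)))
    (fun x _ => (hf x).continuousAt.continuousWithinAt)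
    (fun x _ => (hf x).hasDerivWithinAt) (by simp [h0, hσ0]) (fun x => ?_)
    fun x hx => hb x (Ico_subset_Icc_self hx)
  have h := (((hσ x).pow (k + 1)).div_const ((k + 1).factorial : ℝ)).const_mul c
  refine h.congr_deriv ?_
  rw [Nat.factorial_succ]
  push_cast
  have h1 : (k.factorial : ℝ) ≠ 0 := by positivity
  have h2 : (k + 1 : ℝ) ≠ 0 := by positivity
  field_simp

/-- Let `F'' = Q F - F₊` in the variable `σ`, with zero Cauchy data at `0`, hold for a sequence
`F 0, F 1, …`, where `F₊` is the successor of `F`. If `F n` grows at most like `n! Kⁿ`, then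
`F 0 = 0`: `m` double integrations give `|F 0| ≤ C (m + 2)! (2L)ᵐ σ²ᵐ / (2m)!`, `L = K + M`. -/
lemma eq_zero_of_cauchy_data {F G : ℕ → ℝ → ℝ} {s Q σ : ℝ → ℝ} {M X C K : ℝ}
    (hs : ∀ x, 0 ≤ s x) (hσ : ∀ x, HasDerivAt σ (s x) x) (hσ0 : σ 0 = 0) (hQ : ∀ x, |Q x| ≤ M)
    (hC : 0 ≤ C) (hK : 0 ≤ K)
    (hF : ∀ n x, HasDerivAt (F n) (s x * G n x) x)
    (hG : ∀ n x, HasDerivAt (G n) (s x * (Q x * F n x - F (n + 1) x)) x)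
    (hF0 : ∀ n, F n 0 = 0) (hG0 : ∀ n, G n 0 = 0)
    (hb : ∀ n, ∀ x ∈ Icc 0 X, |F n x| ≤ C * ((n + 2).factorial * K ^ n)) :
    ∀ x ∈ Icc 0 X, F 0 x = 0 := by
  have hM : 0 ≤ M := (abs_nonneg _).trans (hQ 0)
  set L := K + M with hL
  have hσn : ∀ x ∈ Icc 0 X, 0 ≤ σ x := fun x hx => by
    rw [← hσ0]
    exact monotone_of_deriv_nonneg (fun x => (hσ x).differentiableAt)
      (fun x => by rw [(hσ x).deriv]; exact hs x) hx.1
  have claim : ∀ m n, ∀ x ∈ Icc 0 X, |F n x| ≤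
      C * (n + m + 2).factorial * L ^ n * (2 * L) ^ m * (σ x ^ (2 * m) / (2 * m).factorial) := by
    intro m
    induction m with
    | zero =>
      intro n x hx
      refine (hb n x hx).trans ?_
      have : K ^ n ≤ L ^ n := by gcongr; linarith
      simp only [add_zero, mul_zero, pow_zero, Nat.factorial_zero, Nat.cast_one, div_one, mul_one,
        mul_assoc]
      gcongr
    | succ m ih =>
      intro n
      set c : ℝ := C * (n + (m + 1) + 2).factorial * L ^ n * (2 * L) ^ (m + 1) with hc
      have h1 : ∀ x ∈ Icc 0 X, |G n x| ≤ c * (σ x ^ (2 * m + 1) / (2 * m + 1).factorial) := by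
        refine abs_le_of_abs_deriv_le_pow (hG0 n) (hG n) hσ hσ0 fun x hx => ?_
        rw [abs_mul, abs_of_nonneg (hs x)]
        gcongr
        · exact hs x
        have i1 := ih n x hx
        have i2 := ih (n + 1) x hx
        set w := σ x ^ (2 * m) / (2 * m).factorial with hw
        have hw0 : 0 ≤ w := by have := hσn x hx; positivity
        have hfac : ((n + m + 2).factorial : ℝ) ≤ (n + (m + 1) + 2).factorial := by
          exact_mod_cast Nat.factorial_le (by omega)
        have e : n + 1 + m + 2 = n + (m + 1) + 2 := by omega
        rw [e] at i2
        calc |Q x * F n x - F (n + 1) x| ≤ |Q x * F n x| + |F (n + 1) x| := abs_sub _ _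
          _ ≤ M * (C * (n + (m + 1) + 2).factorial * L ^ n * (2 * L) ^ m * w) +
              C * (n + (m + 1) + 2).factorial * L ^ (n + 1) * (2 * L) ^ m * w := by
            rw [abs_mul]
            gcongr
            · exact hQ x
            · exact i1.trans (by gcongr)
          _ = (M + L) * (C * (n + (m + 1) + 2).factorial * L ^ n * (2 * L) ^ m * w) := by ring
          _ ≤ (2 * L) * (C * (n + (m + 1) + 2).factorial * L ^ n * (2 * L) ^ m * w) := by
            gcongr; linarith
          _ = c * w := by rw [hc]; ring
      refine abs_le_of_abs_deriv_le_pow (hF0 n) (hF n) hσ hσ0 fun x hx => ?_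
      rw [abs_mul, abs_of_nonneg (hs x)]
      exact mul_le_mul_of_nonneg_left (h1 x hx) (hs x)
  intro x hx
  have hlim : Tendsto (fun m : ℕ => 2 * C * ((8 * L * σ x ^ 2) ^ m / m.factorial)) atTop (𝓝 0) := by
    simpa using (FloorSemiring.tendsto_pow_div_factorial_atTop (8 * L * σ x ^ 2)).const_mul (2 * C)
  refine abs_nonpos_iff.mp (ge_of_tendsto' hlim fun m => (claim m 0 x hx).trans ?_)
  -- `(m + 2)! ≤ 2 · 4ᵐ m!` and `(2m)! ≥ m!²` reduce the bound to `2C (8Lσ²)ᵐ / m! → 0`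
  have hf1 : ((m + 2).factorial : ℝ) ≤ 2 * 4 ^ m * m.factorial := by
    have h1 : m + 1 ≤ 2 ^ m := Nat.lt_two_pow_self
    have h2 : (m + 2) * (m + 1) ≤ 2 * 4 ^ m := by
      rw [show 4 = 2 * 2 by rfl, mul_pow]
      nlinarith
    have h3 : (m + 2).factorial ≤ 2 * 4 ^ m * m.factorial := by
      rw [Nat.factorial_succ, Nat.factorial_succ, ← mul_assoc]
      exact Nat.mul_le_mul_right _ h2
    exact_mod_cast h3
  have hf2 : (m.factorial * m.factorial : ℝ) ≤ (2 * m).factorial := by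
    rw [two_mul]
    exact_mod_cast Nat.le_of_dvd (Nat.factorial_pos _)
      (Nat.factorial_mul_factorial_dvd_factorial_add m m)
  have hσx := hσn x hx
  have hp : (0 : ℝ) < m.factorial := by positivity
  rw [zero_add, pow_zero, mul_one]
  calc C * (m + 2).factorial * (2 * L) ^ m * (σ x ^ (2 * m) / (2 * m).factorial)
      ≤ C * (2 * 4 ^ m * m.factorial) * (2 * L) ^ m *
          (σ x ^ (2 * m) / (m.factorial * m.factorial)) := by
        gcongr
    _ = _ := by
      rw [pow_mul, mul_pow, mul_pow, mul_pow, show (8 : ℝ) = 4 * 2 by norm_num, mul_pow]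
      field_simp

/-! ### Test functions and the space `ℍ¹` -/

lemma locallyIntegrable_continuous_mul {c f : ℝ → ℝ} (hc : Continuous c)
    (hf : LocallyIntegrable f) : LocallyIntegrable fun x => c x * f x := by
  rw [locallyIntegrable_iff] at hf ⊢
  exact fun K hK => (hf K hK).continuousOn_mul hc.continuousOn hK

lemma hasWeakDeriv_of_hasDerivAt {w w' : ℝ → ℝ} (hw : ∀ x, HasDerivAt w (w' x) x)
    (hw' : Continuous w') (hc : HasCompactSupport w) : HasWeakDeriv w w' := by
  have hwc : Continuous w := continuous_iff_continuousAt.mpr fun x => (hw x).continuousAt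
  have e : w' = deriv w := funext fun x => (hw x).deriv.symm
  have hc' : HasCompactSupport w' := e ▸ hc.deriv
  refine ⟨hwc.locallyIntegrable, hw'.locallyIntegrable, fun φ hφ hφc => ?_⟩
  have hφ' : Continuous (deriv φ) := hφ.continuous_deriv (by simp)
  refine integral_mul_deriv_eq_deriv_mul_of_integrable (fun x _ => hw x)
    (fun x _ => (hφ.differentiable (by simp) x).hasDerivAt) ?_ ?_ ?_
  · exact (hwc.mul hφ').integrable_of_hasCompactSupport hc.mul_right
  · exact (hw'.mul hφ.continuous).integrable_of_hasCompactSupport hc'.mul_right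
  · exact (hwc.mul hφ.continuous).integrable_of_hasCompactSupport hc.mul_right

lemma HasWeakDeriv.congr_right {f g h : ℝ → ℝ} (H : HasWeakDeriv f h) (e : h =ᵐ[volume] g) :
    HasWeakDeriv f g := by
  refine ⟨H.1, locallyIntegrable_congr_ae H.2.1 e, fun φ hφ hc => ?_⟩
  rw [H.2.2 φ hφ hc]
  congr 1
  refine integral_congr_ae ?_
  filter_upwards [e] with x hx
  rw [hx]

namespace Coefficients

variable (A : Coefficients)

/-- The derivative `√(ρ/k)` of `σ`. -/
def dsigma (x : ℝ) : ℝ := √(A.ρ x / A.k x)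

lemma dsigma_continuous : Continuous A.dsigma :=
  Real.continuous_sqrt.comp (A.ρ_continuous.div A.k_continuous fun x => (A.k_pos' x).ne')

lemma dsigma_pos (x : ℝ) : 0 < A.dsigma x :=
  Real.sqrt_pos.mpr (div_pos (A.ρ_pos' x) (A.k_pos' x))

lemma dsigma_mul_sqrt (x : ℝ) : A.dsigma x * √(A.k x / A.ρ x) = 1 := by
  have hρ := A.ρ_pos' x
  have hk := A.k_pos' x
  rw [dsigma, ← Real.sqrt_mul (by positivity), div_mul_div_cancel₀ hk.ne', div_self hρ.ne',
    Real.sqrt_one]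

lemma sqrt_continuous : Continuous fun x => √(A.k x / A.ρ x) :=
  Real.continuous_sqrt.comp (A.k_continuous.div A.ρ_continuous fun x => (A.ρ_pos' x).ne')

/-- Differentiability at `0` holds because the one-sided derivative of the even function `kρ`
vanishes there. -/
lemma hasDerivAt_kρ (x : ℝ) :
    HasDerivAt (fun y => A.k y * A.ρ y) (deriv (fun y => A.k y * A.ρ y) x) x := by
  set P : ℝ → ℝ := fun y => A.k y * A.ρ y with hP
  have hPe : (fun y => P (-y)) = P := funext fun x => by simp only [hP, A.k_even, A.ρ_even]
  have hPc : ContDiffOn ℝ 2 P (Ici 0) := by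
    refine A.ρk_contDiff.congr fun x _ => ?_
    simp only [hP]; ring
  have hpos : ∀ x, 0 < x → DifferentiableAt ℝ P x := fun x hx =>
    (hPc.differentiableOn (by norm_num)).differentiableAt (Ici_mem_nhds hx)
  refine DifferentiableAt.hasDerivAt ?_
  rcases lt_trichotomy x 0 with hx | rfl | hx
  · have h1 : DifferentiableAt ℝ (fun y => P (-y)) x :=
      (hpos (-x) (neg_pos.mpr hx)).comp x differentiableAt_id.neg
    rwa [hPe] at h1
  · have h0 : HasDerivWithinAt P 0 (Ici 0) 0 := by
      refine A.ρk_deriv_zero.congr (fun x _ => ?_) ?_ <;> simp only [hP] <;> ring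
    have h1 : HasDerivWithinAt (P ∘ fun y => -y) (0 * -1) (Iic 0) 0 := by
      refine HasDerivWithinAt.comp (h := fun y : ℝ => -y) (s' := Ici 0) (0 : ℝ) ?_
        (hasDerivAt_neg (0 : ℝ)).hasDerivWithinAt fun y hy => by simpa using hy
      simpa using h0
    have e : (P ∘ fun y => -y) = P := hPe
    rw [e, zero_mul] at h1
    have h2 := h1.union h0
    rw [Iic_union_Ici, hasDerivWithinAt_univ] at h2
    exact h2.differentiableAt
  · exact hpos x hx

/-- The Liouville factor `(ρk)^{1/4}`: `f ↦ (ρk)^{1/4} f` turns `𝔻_{ρk}` into `d/dσ`. -/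
def amp (x : ℝ) : ℝ := √√(A.k x * A.ρ x)

lemma kρ_pos (x : ℝ) : 0 < A.k x * A.ρ x := mul_pos (A.k_pos' x) (A.ρ_pos' x)

lemma amp_pos (x : ℝ) : 0 < A.amp x := Real.sqrt_pos.mpr (Real.sqrt_pos.mpr (A.kρ_pos x))

lemma amp_continuous : Continuous A.amp :=
  Real.continuous_sqrt.comp (Real.continuous_sqrt.comp (A.k_continuous.mul A.ρ_continuous))

lemma amp_even (x : ℝ) : A.amp (-x) = A.amp x := by rw [amp, amp, A.k_even, A.ρ_even]

lemma amp_sq (x : ℝ) : A.amp x ^ 2 = √(A.k x * A.ρ x) := Real.sq_sqrt (Real.sqrt_nonneg _)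

lemma amp_sq_mul_dsigma (x : ℝ) : A.amp x ^ 2 * A.dsigma x = A.ρ x := by
  have hk := A.k_pos' x
  rw [amp_sq, dsigma, ← Real.sqrt_mul (A.kρ_pos x).le]
  have : A.k x * A.ρ x * (A.ρ x / A.k x) = A.ρ x * A.ρ x := by field_simp
  rw [this, Real.sqrt_mul_self (A.ρ_pos' x).le]

/-- `d/dσ (ρk)^{1/4} = Q₁ (ρk)^{1/4}`. -/
lemma hasDerivAt_amp (x : ℝ) :
    HasDerivAt A.amp (A.dsigma x * Q1 A.ρ A.k x * A.amp x) x := by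
  have hP := A.kρ_pos x
  have h := ((A.hasDerivAt_kρ x).sqrt hP.ne').sqrt (Real.sqrt_pos.mpr hP).ne'
  refine h.congr_deriv ?_
  set d := deriv (fun y => A.k y * A.ρ y) x
  have e : A.dsigma x * Q1 A.ρ A.k x = d / (4 * (A.k x * A.ρ x)) := by
    rw [Q1, ← mul_div_assoc, ← mul_assoc, dsigma_mul_sqrt, one_mul]
  have hs2 : A.amp x ^ 4 = A.k x * A.ρ x := by
    rw [show 4 = 2 * 2 by rfl, pow_mul, amp_sq, Real.sq_sqrt hP.le]
  have ha := A.amp_pos x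
  change d / (2 * √(A.k x * A.ρ x)) / (2 * A.amp x) = _
  rw [e, ← A.amp_sq, ← hs2]
  field_simp
  norm_num

lemma locallyIntegrable_of_μ {f : ℝ → ℝ} (h1 : LocallyIntegrable f A.μ) : LocallyIntegrable f := by
  have h2 : LocallyIntegrable fun x => A.ρ x * f x := by
    intro x
    obtain ⟨t, ht, hi⟩ := h1 x
    obtain ⟨t', ht', hm, htm⟩ := mem_nhds_iff.mp ht
    refine ⟨t', hm.mem_nhds htm, ?_⟩
    have h3 := hi.mono_set ht'
    rw [IntegrableOn, μ, restrict_withDensity hm.measurableSet,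
      integrable_withDensity_iff_integrable_smul' A.ρ_continuous.measurable.ennreal_ofReal
      (Eventually.of_forall fun x => ENNReal.ofReal_lt_top)] at h3
    rw [IntegrableOn]
    simpa only [smul_eq_mul, ENNReal.toReal_ofReal (A.ρ_pos' _).le] using h3
  have h3 := locallyIntegrable_continuous_mul (c := fun x => (A.ρ x)⁻¹)
    (A.ρ_continuous.inv₀ fun x => (A.ρ_pos' x).ne') h2
  refine locallyIntegrable_congr_ae h3 (Eventually.of_forall fun x => ?_)
  exact inv_mul_cancel_left₀ (A.ρ_pos' x).ne' _

lemma locallyIntegrable_L2 (f : A.L2) : LocallyIntegrable f :=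
  A.locallyIntegrable_of_μ ((Lp.memLp f).locallyIntegrable (by norm_num))

/-- A continuous function with compact support as an element of `L²_ρ(ℝ)`. -/
def testL2 (g : ℝ → ℝ) (hg : Continuous g) (hc : HasCompactSupport g) : A.L2 :=
  (hg.memLp_of_hasCompactSupport hc : MemLp g 2 A.μ).toLp

lemma testL2_coe (g : ℝ → ℝ) (hg : Continuous g) (hc : HasCompactSupport g) :
    A.testL2 g hg hc =ᵐ[volume] g :=
  A.volume_ac.ae_eq (MemLp.coeFn_toLp _)

lemma inner_L2 (f g : A.L2) : inner ℝ f g = ∫ x, A.ρ x * (f x * g x) := by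
  rw [MeasureTheory.L2.inner_def, ← A.integral_μ]
  exact integral_congr_ae (Eventually.of_forall fun x => by simp [mul_comm])

lemma inner_testL2 (g : ℝ → ℝ) (hg : Continuous g) (hc : HasCompactSupport g) (f : A.L2) :
    inner ℝ (A.testL2 g hg hc) f = ∫ x, A.ρ x * (g x * f x) := by
  rw [inner_L2]
  refine integral_congr_ae ?_
  filter_upwards [A.testL2_coe g hg hc] with x hx
  rw [hx]

lemma locallyIntegrable_weakDeriv (f g : A.L2) :
    LocallyIntegrable fun x => A.dsigma x * (g x - Q1 A.ρ A.k x * f x) :=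
  locallyIntegrable_continuous_mul A.dsigma_continuous
    ((A.locallyIntegrable_L2 g).sub
      (locallyIntegrable_continuous_mul A.Q1_continuous (A.locallyIntegrable_L2 f)))

/-- `𝔻_{ρk} f = g` solved for the weak derivative of `f`. -/
lemma isD_iff (f g : A.L2) : A.IsD f g ↔
    HasWeakDeriv f fun x => A.dsigma x * (g x - Q1 A.ρ A.k x * f x) := by
  constructor
  · rintro ⟨f', hf, hg⟩
    refine hf.congr_right ?_
    filter_upwards [hg] with x hx
    rw [hx]
    linear_combination (-f' x) * A.dsigma_mul_sqrt x
  · refine fun h => ⟨_, h, Eventually.of_forall fun x => ?_⟩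
    simp only []
    linear_combination (Q1 A.ρ A.k x * f x - g x) * A.dsigma_mul_sqrt x

lemma integrable_mul_test {h φ : ℝ → ℝ} (hh : LocallyIntegrable h) (hφ : Continuous φ)
    (hc : HasCompactSupport φ) : Integrable fun x => h x * φ x := by
  simpa [mul_comm] using hh.integrable_smul_left_of_hasCompactSupport hφ hc

section Test

variable {φ : ℝ → ℝ} (hφ : ContDiff ℝ ∞ φ) (hc : HasCompactSupport φ)

/-- The function `(φ' - √(ρ/k) Q₁ φ) / ρ`: with `testSnd`, the vector which tests the weak equation
`𝔻_{ρk} f = g` against `φ`. -/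
def testFst : A.L2 :=
  A.testL2 (fun x => (A.ρ x)⁻¹ * (deriv φ x - A.dsigma x * Q1 A.ρ A.k x * φ x))
    ((A.ρ_continuous.inv₀ fun x => (A.ρ_pos' x).ne').mul
      ((hφ.continuous_deriv (by simp)).sub
        ((A.dsigma_continuous.mul A.Q1_continuous).mul hφ.continuous)))
    (HasCompactSupport.mul_left (hc.deriv.sub (hc.mul_left)))

/-- The function `√(ρ/k) φ / ρ`. -/
def testSnd : A.L2 :=
  A.testL2 (fun x => (A.ρ x)⁻¹ * (A.dsigma x * φ x))
    ((A.ρ_continuous.inv₀ fun x => (A.ρ_pos' x).ne').mul (A.dsigma_continuous.mul hφ.continuous))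
    (HasCompactSupport.mul_left hc.mul_left)

lemma inner_testFst (f : A.L2) : inner ℝ (A.testFst hφ hc) f =
    (∫ x, f x * deriv φ x) - ∫ x, A.dsigma x * (Q1 A.ρ A.k x * f x) * φ x := by
  rw [testFst, inner_testL2, ← integral_sub (integrable_mul_test (A.locallyIntegrable_L2 f)
    (hφ.continuous_deriv (by simp)) hc.deriv) (integrable_mul_test
    (locallyIntegrable_continuous_mul A.dsigma_continuous
      (locallyIntegrable_continuous_mul A.Q1_continuous (A.locallyIntegrable_L2 f)))
    hφ.continuous hc)]
  refine integral_congr_ae (Eventually.of_forall fun x => ?_)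
  have := (A.ρ_pos' x).ne'
  simp only []
  field_simp

lemma inner_testSnd (g : A.L2) : inner ℝ (A.testSnd hφ hc) g =
    ∫ x, A.dsigma x * g x * φ x := by
  rw [testSnd, inner_testL2]
  refine integral_congr_ae (Eventually.of_forall fun x => ?_)
  have := (A.ρ_pos' x).ne'
  simp only []
  field_simp

end Test

/-- Membership in `ℍ¹` is a family of continuous linear conditions on the pair `(f, g)`. -/
lemma isD_iff_inner (f g : A.L2) : A.IsD f g ↔
    ∀ (φ : ℝ → ℝ) (hφ : ContDiff ℝ ∞ φ) (hc : HasCompactSupport φ),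
      inner ℝ (A.testFst hφ hc) f + inner ℝ (A.testSnd hφ hc) g = 0 := by
  have key : ∀ (φ : ℝ → ℝ) (hφ : ContDiff ℝ ∞ φ) (hc : HasCompactSupport φ),
      ∫ x, A.dsigma x * (g x - Q1 A.ρ A.k x * f x) * φ x =
      (∫ x, A.dsigma x * g x * φ x) - ∫ x, A.dsigma x * (Q1 A.ρ A.k x * f x) * φ x :=
    fun φ hφ hc => by
    rw [← integral_sub (integrable_mul_test (locallyIntegrable_continuous_mul A.dsigma_continuous
      (A.locallyIntegrable_L2 g)) hφ.continuous hc) (integrable_mul_test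
      (locallyIntegrable_continuous_mul A.dsigma_continuous
        (locallyIntegrable_continuous_mul A.Q1_continuous (A.locallyIntegrable_L2 f)))
        hφ.continuous hc)]
    exact integral_congr_ae (Eventually.of_forall fun x => by simp only []; ring)
  rw [isD_iff]
  constructor
  · intro h φ hφ hc
    rw [inner_testFst, inner_testSnd, h.2.2 φ hφ hc, key φ hφ hc]
    ring
  · refine fun h => ⟨A.locallyIntegrable_L2 f, A.locallyIntegrable_weakDeriv f g,
      fun φ hφ hc => ?_⟩
    have := h φ hφ hc
    rw [inner_testFst, inner_testSnd] at this
    rw [key φ hφ hc]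
    linarith

lemma isClosed_H1 : IsClosed (A.H1 : Set (WithLp 2 (A.L2 × A.L2))) := by
  have e : (A.H1 : Set (WithLp 2 (A.L2 × A.L2))) =
      ⋂ (φ : ℝ → ℝ) (hφ : ContDiff ℝ ∞ φ) (hc : HasCompactSupport φ),
        {w | inner ℝ (A.testFst hφ hc) w.fst + inner ℝ (A.testSnd hφ hc) w.snd = 0} := by
    ext w
    simp only [mem_iInter, mem_ofPred_eq]
    exact A.isD_iff_inner w.fst w.snd
  rw [e]
  refine isClosed_iInter fun φ => isClosed_iInter fun hφ => isClosed_iInter fun hc => ?_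
  have h1 : Continuous fun w : WithLp 2 (A.L2 × A.L2) => w.fst := (WithLp.fstL 2 ℝ _ _).continuous
  have h2 : Continuous fun w : WithLp 2 (A.L2 × A.L2) => w.snd := (WithLp.sndL 2 ℝ _ _).continuous
  exact isClosed_eq ((continuous_const.inner h1).add (continuous_const.inner h2)) continuous_const

instance : CompleteSpace A.H1 := A.isClosed_H1.completeSpace_coe

/-- The element of `ℍ¹` given by `f` and `g = 𝔻_{ρk} f`. -/
def mkH1 (f g : A.L2) (h : A.IsD f g) : A.H1 := ⟨WithLp.toLp 2 (f, g), h⟩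

@[simp] lemma incl_mkH1 (f g : A.L2) (h : A.IsD f g) : A.incl (A.mkH1 f g h) = f := rfl

@[simp] lemma D_mkH1 (f g : A.L2) (h : A.IsD f g) : A.D (A.mkH1 f g h) = g := rfl

lemma isD_H1 (f : A.H1) : A.IsD (A.incl f) (A.D f) := f.2

lemma norm_sq_H1 (f : A.H1) : ‖f‖ ^ 2 = ‖A.incl f‖ ^ 2 + ‖A.D f‖ ^ 2 :=
  WithLp.prod_norm_sq_eq_of_L2 _

/-- `𝔻_{ρk} f` is determined by `f`. -/
lemma incl_injective : Function.Injective A.incl := by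
  refine (injective_iff_map_eq_zero _).mpr fun f hf => ?_
  have h := (A.isD_iff _ _).mp (A.isD_H1 f)
  have h0 : (A.incl f : ℝ → ℝ) =ᵐ[volume] 0 := by
    rw [hf]; exact A.volume_ac.ae_eq (Lp.coeFn_zero ℝ 2 A.μ)
  have h1 : ∀ᵐ x, A.dsigma x * (A.D f x - Q1 A.ρ A.k x * A.incl f x) = 0 := by
    refine ae_eq_zero_of_integral_contDiff_smul_eq_zero h.2.1 fun φ hφ hc => ?_
    have h2 := h.2.2 φ hφ hc
    have h3 : ∫ x, A.incl f x * deriv φ x = 0 := by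
      rw [integral_eq_zero_of_ae]
      filter_upwards [h0] with x hx
      simp [hx]
    rw [h3, zero_eq_neg] at h2
    rw [← h2]
    exact integral_congr_ae (Eventually.of_forall fun x => by simp [mul_comm])
  have h2 : (A.D f : ℝ → ℝ) =ᵐ[volume] 0 := by
    filter_upwards [h0, h1] with x hx hx1
    rw [hx] at hx1
    have := A.dsigma_pos x
    simpa [this.ne'] using hx1
  have hμ : A.μ ≪ volume := withDensity_absolutelyContinuous _ _
  have h3 : A.D f = 0 := Lp.ext ((hμ.ae_eq h2).trans (Lp.coeFn_zero ℝ 2 A.μ).symm)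
  have := A.norm_sq_H1 f
  rw [hf, h3] at this
  simpa using this

/-- `𝔻_{ρk}` is maximal skew-adjoint: if `⟨g, 𝔻 w⟩ = -⟨r, w⟩` for all `w ∈ ℍ¹`, then `g ∈ ℍ¹`
and `𝔻 g = r`. The test functions are `w = φ / √(ρk)` with `φ ∈ C_c^∞`. -/
lemma isD_of_forall_inner {g r : A.L2}
    (h : ∀ w : A.H1, inner ℝ g (A.D w) + inner ℝ r (A.incl w) = 0) : A.IsD g r := by
  rw [isD_iff_inner]
  intro φ hφ hc
  set w : ℝ → ℝ := fun x => φ x * (A.amp x ^ 2)⁻¹ with hw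
  set w' : ℝ → ℝ := fun x =>
    deriv φ x * (A.amp x ^ 2)⁻¹ - φ x * (2 * (A.dsigma x * Q1 A.ρ A.k x)) * (A.amp x ^ 2)⁻¹ with hw'
  have hφ' : Continuous (deriv φ) := hφ.continuous_deriv (by simp)
  have hamp : Continuous fun x => (A.amp x ^ 2)⁻¹ :=
    (A.amp_continuous.pow 2).inv₀ fun x => (pow_pos (A.amp_pos x) 2).ne'
  have hder : ∀ x, HasDerivAt w (w' x) x := fun x => by
    have ha := (A.amp_pos x).ne'
    have h1 := (hφ.differentiable (by simp) x).hasDerivAt.mul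
      (((A.hasDerivAt_amp x).pow 2).inv (pow_ne_zero 2 ha))
    refine h1.congr_deriv ?_
    simp only [hw', Nat.cast_ofNat, Pi.pow_apply, Pi.inv_apply]
    field_simp
    ring
  have hwc : HasCompactSupport w := hc.mul_right
  have hwcont : Continuous w := hφ.continuous.mul hamp
  have hwcont' : Continuous w' := (hφ'.mul hamp).sub ((hφ.continuous.mul
    (continuous_const.mul (A.dsigma_continuous.mul A.Q1_continuous))).mul hamp)
  have hw'c : HasCompactSupport w' := by
    have e : w' = deriv w := funext fun x => (hder x).deriv.symm
    exact e ▸ hwc.deriv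
  set d : ℝ → ℝ := fun x => √(A.k x / A.ρ x) * w' x + Q1 A.ρ A.k x * w x with hd
  have hdcont : Continuous d := (A.sqrt_continuous.mul hwcont').add (A.Q1_continuous.mul hwcont)
  have hdc : HasCompactSupport d := (hw'c.mul_left).add (hwc.mul_left)
  have hIsD : A.IsD (A.testL2 w hwcont hwc) (A.testL2 d hdcont hdc) := by
    refine ⟨w', (hasWeakDeriv_of_hasDerivAt hder hwcont' hwc).congr_left
      (A.testL2_coe w hwcont hwc).symm, ?_⟩
    filter_upwards [A.testL2_coe w hwcont hwc, A.testL2_coe d hdcont hdc] with x h1 h2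
    rw [h1, h2]
  have key := h (A.mkH1 _ _ hIsD)
  rw [incl_mkH1, D_mkH1, real_inner_comm, real_inner_comm (A.testL2 w hwcont hwc)] at key
  rw [← key]
  congr 1
  · rw [testFst, inner_testL2, inner_testL2]
    refine integral_congr_ae (Eventually.of_forall fun x => ?_)
    have ha := (A.amp_pos x).ne'
    have hρ := (A.ρ_pos' x).ne'
    have e1 : A.ρ x * √(A.k x / A.ρ x) = A.amp x ^ 2 := by
      linear_combination (-√(A.k x / A.ρ x)) * A.amp_sq_mul_dsigma x +
        A.amp x ^ 2 * A.dsigma_mul_sqrt x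
    have e2 : A.ρ x * (A.amp x ^ 2)⁻¹ = A.dsigma x := by
      rw [← A.amp_sq_mul_dsigma x]; field_simp
    have e3 : A.ρ x * d x = deriv φ x - A.dsigma x * Q1 A.ρ A.k x * φ x := by
      have e4 : A.ρ x * d x = (A.ρ x * √(A.k x / A.ρ x)) * w' x +
          Q1 A.ρ A.k x * φ x * (A.ρ x * (A.amp x ^ 2)⁻¹) := by simp only [hd, hw]; ring
      rw [e4, e1, e2]
      simp only [hw']
      field_simp
      ring
    simp only []
    rw [← mul_assoc, ← mul_assoc (A.ρ x) (d x), e3, mul_inv_cancel_left₀ hρ]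
  · rw [testSnd, inner_testL2, inner_testL2]
    refine integral_congr_ae (Eventually.of_forall fun x => ?_)
    have ha := (A.amp_pos x).ne'
    have hρ := (A.ρ_pos' x).ne'
    simp only [hw]
    rw [← A.amp_sq_mul_dsigma x]
    have := (A.dsigma_pos x).ne'
    field_simp

end Coefficients

/-! ### Reflection and the form of the equation -/

lemma HasWeakDeriv.comp_neg {f h : ℝ → ℝ} (H : HasWeakDeriv f h) :
    HasWeakDeriv (fun x => f (-x)) (fun x => -h (-x)) := by
  have loc : ∀ g : ℝ → ℝ, LocallyIntegrable g → LocallyIntegrable fun x => g (-x) := fun g hg => by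
    rw [locallyIntegrable_iff] at hg ⊢
    intro K hK
    have h1 := ((Measure.measurePreserving_neg (volume : Measure ℝ)).integrableOn_comp_preimage
      (Homeomorph.neg ℝ).measurableEmbedding (f := g) (s := -K)).mpr (hg _ hK.neg)
    rwa [neg_preimage, neg_neg] at h1
  refine ⟨loc f H.1, (loc h H.2.1).neg, fun φ hφ hc => ?_⟩
  have h1 := H.2.2 (fun x => φ (-x)) (hφ.comp contDiff_neg)
    (hc.comp_homeomorph (Homeomorph.neg ℝ))
  rw [← integral_neg_eq_self, ← integral_neg_eq_self (fun x => -h (-x) * φ x)]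
  simp only [deriv_comp_neg, mul_neg, neg_neg, neg_mul, integral_neg] at h1 ⊢
  linarith

namespace Coefficients

variable (A : Coefficients)

lemma measurePreserving_neg : MeasurePreserving (fun x : ℝ => -x) A.μ A.μ := by
  refine ⟨measurable_neg, Measure.ext fun t ht => ?_⟩
  rw [Measure.map_apply measurable_neg ht, μ, withDensity_apply _ ht,
    withDensity_apply _ (measurable_neg ht),
    ← (Measure.measurePreserving_neg (volume : Measure ℝ)).setLIntegral_comp_preimage ht
      A.ρ_continuous.measurable.ennreal_ofReal]
  simp only [A.ρ_even]

/-- The reflection `f ↦ f(-·)` of `L²_ρ(ℝ)`. -/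
def reflL2 : A.L2 →ₗᵢ[ℝ] A.L2 := Lp.compMeasurePreservingₗᵢ ℝ (fun x => -x) A.measurePreserving_neg

lemma reflL2_coe (f : A.L2) : A.reflL2 f =ᵐ[volume] fun x => f (-x) :=
  A.volume_ac.ae_eq (Lp.coeFn_compMeasurePreserving f A.measurePreserving_neg)

lemma μ_ac : A.μ ≪ volume := withDensity_absolutelyContinuous _ _

lemma ext_L2 {f g : A.L2} (h : f =ᵐ[volume] g) : f = g := Lp.ext (A.μ_ac.ae_eq h)

lemma ae_neg {p : ℝ → Prop} (h : ∀ᵐ x, p x) : ∀ᵐ x : ℝ, p (-x) :=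
  (Measure.measurePreserving_neg (volume : Measure ℝ)).quasiMeasurePreserving.ae h

lemma reflL2_reflL2 (f : A.L2) : A.reflL2 (A.reflL2 f) = f := by
  refine A.ext_L2 ?_
  filter_upwards [A.reflL2_coe (A.reflL2 f), ae_neg (A.reflL2_coe f)] with x h1 h2
  rw [h1, h2, neg_neg]

lemma inner_reflL2 (f g : A.L2) : inner ℝ (A.reflL2 f) g = inner ℝ f (A.reflL2 g) := by
  conv_lhs => rw [← A.reflL2_reflL2 g]
  exact A.reflL2.inner_map_map _ _

lemma isD_refl {f g : A.L2} (h : A.IsD f g) : A.IsD (A.reflL2 f) ↑(-A.reflL2 g : A.L2) := by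
  obtain ⟨f', hf, hg⟩ := h
  refine ⟨fun x => -f' (-x), hf.comp_neg.congr_left (A.reflL2_coe f).symm, ?_⟩
  filter_upwards [ae_neg hg, A.reflL2_coe f, A.reflL2_coe g,
    A.volume_ac.ae_eq (Lp.coeFn_neg (A.reflL2 g))] with x h1 h2 h3 h4
  rw [h4, Pi.neg_apply, h3, h1, h2, A.Q1_odd, A.k_even, A.ρ_even]
  ring

/-- The reflection `f ↦ f(-·)` of `ℍ¹`. -/
def refl (f : A.H1) : A.H1 := A.mkH1 _ _ (A.isD_refl (A.isD_H1 f))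

@[simp] lemma incl_refl (f : A.H1) : A.incl (A.refl f) = A.reflL2 (A.incl f) := rfl

@[simp] lemma D_refl (f : A.H1) : A.D (A.refl f) = -A.reflL2 (A.D f) := rfl

lemma mem_evenH1_iff (f : A.H1) : f ∈ A.EvenH1 ↔ A.refl f = f := by
  have h1 : f ∈ A.EvenH1 ↔ A.reflL2 (A.incl f) = A.incl f := by
    change (∀ᵐ x : ℝ, A.incl f (-x) = A.incl f x) ↔ _
    constructor
    · intro h
      refine A.ext_L2 ?_
      filter_upwards [h, A.reflL2_coe (A.incl f)] with x h1 h2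
      rw [h2, h1]
    · intro h
      have := A.reflL2_coe (A.incl f)
      rw [h] at this
      filter_upwards [this] with x hx
      exact hx.symm
  rw [h1, ← incl_refl, A.incl_injective.eq_iff]

lemma delta_refl (f : A.H1) : A.delta (A.refl f) = A.delta f := by
  obtain ⟨F, hF, hFf, -⟩ := A.exists_delta.choose_spec f
  rw [A.delta_apply f F hF hFf, A.delta_apply (A.refl f) (fun x => F (-x)) (hF.comp continuous_neg)
    ?_, neg_zero]
  filter_upwards [ae_neg hFf, A.reflL2_coe (A.incl f)] with x h1 h2
  rw [h1, incl_refl, h2]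

/-- A bound for `|q|`, chosen arbitrarily. -/
def qBound : ℝ := A.exists_q_bound.choose

lemma abs_q_le (x : ℝ) : |A.q x| ≤ A.qBound := A.exists_q_bound.choose_spec x

lemma qBound_nonneg : 0 ≤ A.qBound := (abs_nonneg _).trans (A.abs_q_le 0)

lemma qMul_coe (f : A.L2) : A.qMul f =ᵐ[volume] fun x => A.q x * f x :=
  A.volume_ac.ae_eq (MemLp.coeFn_toLp _)

/-- Multiplication by `q` as a bounded operator of `L²_ρ(ℝ)`. -/
def qOp : A.L2 →L[ℝ] A.L2 :=
  LinearMap.mkContinuous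
    { toFun := A.qMul
      map_add' := fun f g => by
        refine A.ext_L2 ?_
        filter_upwards [A.qMul_coe (f + g), A.qMul_coe f, A.qMul_coe g,
          A.volume_ac.ae_eq (Lp.coeFn_add f g),
          A.volume_ac.ae_eq (Lp.coeFn_add (A.qMul f) (A.qMul g))] with x h1 h2 h3 h4 h5
        rw [h1, h5, Pi.add_apply, h2, h3, h4, Pi.add_apply]
        ring
      map_smul' := fun c f => by
        refine A.ext_L2 ?_
        filter_upwards [A.qMul_coe (c • f), A.qMul_coe f,
          A.volume_ac.ae_eq (Lp.coeFn_smul c f),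
          A.volume_ac.ae_eq (Lp.coeFn_smul c (A.qMul f))] with x h1 h2 h3 h4
        rw [h1, RingHom.id_apply, h4, Pi.smul_apply, h2, h3, Pi.smul_apply]
        simp only [smul_eq_mul]
        ring } A.qBound fun f => by
    refine Lp.norm_le_mul_norm_of_ae_le_mul ?_
    filter_upwards [A.μ_ac.ae_eq (A.qMul_coe f)] with x hx
    change ‖A.qMul f x‖ ≤ _
    rw [hx, norm_mul]
    exact mul_le_mul_of_nonneg_right (A.abs_q_le x) (norm_nonneg _)

lemma norm_qMul_le (f : A.L2) : ‖A.qMul f‖ ≤ A.qBound * ‖f‖ :=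
  (A.qOp.le_opNorm f).trans (mul_le_mul_of_nonneg_right
    (LinearMap.mkContinuous_norm_le _ A.qBound_nonneg _) (norm_nonneg _))

lemma inner_qMul_comm (f g : A.L2) : inner ℝ (A.qMul f) g = inner ℝ (A.qMul g) f := by
  rw [inner_L2, inner_L2]
  refine integral_congr_ae ?_
  filter_upwards [A.qMul_coe f, A.qMul_coe g] with x h1 h2
  rw [h1, h2]
  ring

lemma reflL2_qMul (f : A.L2) : A.reflL2 (A.qMul f) = A.qMul (A.reflL2 f) := by
  refine A.ext_L2 ?_
  filter_upwards [A.reflL2_coe (A.qMul f), A.reflL2_coe f, A.qMul_coe (A.reflL2 f),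
    ae_neg (A.qMul_coe f)] with x h1 h2 h3 h4
  rw [h1, h4, h3, h2, A.q_even]

/-- The shift `λ` which makes the form of `-𝔻² + q + λ` coercive. -/
def shift : ℝ := A.qBound + 1

/-- The form `⟨𝔻 v, 𝔻 w⟩ + ⟨q v, w⟩ + λ ⟨v, w⟩` on `ℍ¹`. -/
def bilin : A.H1 →L[ℝ] A.H1 →L[ℝ] ℝ :=
  (ContinuousLinearMap.precomp ℝ A.D).comp ((innerSL ℝ).comp A.D) +
  (ContinuousLinearMap.precomp ℝ A.incl).comp ((innerSL ℝ).comp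
    ((A.qOp + A.shift • ContinuousLinearMap.id ℝ A.L2).comp A.incl))

lemma bilin_apply (v w : A.H1) : A.bilin v w = inner ℝ (A.D v) (A.D w) +
    inner ℝ (A.qMul (A.incl v)) (A.incl w) + A.shift * inner ℝ (A.incl v) (A.incl w) := by
  change inner ℝ (A.D v) (A.D w) + inner ℝ (A.qMul (A.incl v) + A.shift • A.incl v) (A.incl w) = _
  rw [inner_add_left, inner_smul_left]
  simp only [conj_trivial]
  ring

lemma norm_sq_le_bilin (v : A.H1) : ‖v‖ ^ 2 ≤ A.bilin v v := by
  rw [bilin_apply, norm_sq_H1, real_inner_self_eq_norm_sq, real_inner_self_eq_norm_sq, shift]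
  have h1 := (abs_le.mp (abs_real_inner_le_norm (A.qMul (A.incl v)) (A.incl v))).1
  have h2 := mul_le_mul_of_nonneg_right (A.norm_qMul_le (A.incl v)) (norm_nonneg (A.incl v))
  nlinarith

lemma isCoercive_bilin : IsCoercive A.bilin :=
  ⟨1, one_pos, fun v => by have := A.norm_sq_le_bilin v; rw [sq] at this; linarith⟩

/-- The operator `Λ = -𝔻² + q + λ` in terms of its form. -/
def triple : FormTriple A.H1 A.L2 where
  j := A.incl
  B := A.isCoercive_bilin.continuousLinearEquivOfBilin
  j_injective := A.incl_injective
  norm_j_le v := by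
    have := A.norm_sq_H1 v
    exact le_of_sq_le_sq (by nlinarith [sq_nonneg ‖A.D v‖]) (norm_nonneg _)
  symm v w := by
    rw [IsCoercive.continuousLinearEquivOfBilin_apply,
      IsCoercive.continuousLinearEquivOfBilin_apply, bilin_apply, bilin_apply, inner_qMul_comm,
      real_inner_comm (A.D w) (A.D v), real_inner_comm (A.incl w) (A.incl v)]
  coercive v := by
    rw [IsCoercive.continuousLinearEquivOfBilin_apply]
    exact A.norm_sq_le_bilin v

@[simp] lemma triple_j : A.triple.j = A.incl := rfl

lemma inner_B (v w : A.H1) : inner ℝ (A.triple.B v) w = inner ℝ (A.D v) (A.D w) +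
    inner ℝ (A.qMul (A.incl v)) (A.incl w) + A.shift * inner ℝ (A.incl v) (A.incl w) := by
  rw [← bilin_apply]
  exact A.isCoercive_bilin.continuousLinearEquivOfBilin_apply v w

lemma inner_B_refl (v w : A.H1) :
    inner ℝ (A.triple.B (A.refl v)) w = inner ℝ (A.triple.B v) (A.refl w) := by
  simp only [inner_B, incl_refl, D_refl, inner_neg_left, inner_neg_right, inner_reflL2,
    ← reflL2_qMul]

lemma eq_of_inner_B {v v' : A.H1}
    (h : ∀ w, inner ℝ (A.triple.B v) w = inner ℝ (A.triple.B v') w) : v = v' :=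
  A.triple.B.injective (ext_inner_right ℝ h)

lemma solve_refl {ℓ : A.Hm1} (h : ∀ w, ℓ (A.refl w) = ℓ w) :
    A.refl (A.triple.solve ℓ) = A.triple.solve ℓ := by
  refine A.eq_of_inner_B fun w => ?_
  rw [inner_B_refl, FormTriple.inner_B_solve, FormTriple.inner_B_solve, h]

lemma E_reflL2 (h : A.L2) : A.triple.E (A.reflL2 h) = A.refl (A.triple.E h) := by
  refine A.eq_of_inner_B fun w => ?_
  rw [inner_B_refl, FormTriple.inner_B_E, FormTriple.inner_B_E, triple_j, incl_refl, inner_reflL2]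

lemma heat_reflL2 (t : ℝ) (m : ℕ) (h : A.L2) :
    A.triple.heat t m (A.reflL2 h) = A.reflL2 (A.triple.heat t m h) := by
  refine A.triple.isEffect_R.funCalc_comm (U := A.reflL2.toContinuousLinearMap) (fun x => ?_) _ h
  change A.triple.R (A.reflL2 x) = A.reflL2 (A.triple.R x)
  rw [FormTriple.R_apply, FormTriple.R_apply, E_reflL2]
  rfl

lemma E_heat_refl (t : ℝ) (m : ℕ) {v : A.H1} (hv : A.refl v = v) :
    A.refl (A.triple.E (A.triple.heat t m (A.incl v))) =
      A.triple.E (A.triple.heat t m (A.incl v)) := by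
  rw [← E_reflL2, ← heat_reflL2, ← incl_refl, hv]

lemma semigroup_refl (t : ℝ) {v : A.H1} (hv : A.refl v = v) :
    A.refl (A.triple.semigroup t v) = A.triple.semigroup t v := by
  rcases lt_or_ge 0 t with ht | ht
  · rw [A.triple.semigroup_of_pos ht]; exact A.E_heat_refl t 1 hv
  · rw [A.triple.semigroup_of_nonpos ht, hv]

/-! ### The Liouville transformation and unique continuation -/

lemma locallyIntegrable_amp_mul (g : A.L2) :
    LocallyIntegrable fun x => A.dsigma x * (A.amp x * g x) :=
  locallyIntegrable_continuous_mul A.dsigma_continuous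
    (locallyIntegrable_continuous_mul A.amp_continuous (A.locallyIntegrable_L2 g))

/-- `d/dσ ((ρk)^{1/4} f) = (ρk)^{1/4} 𝔻 f`, in integrated form. -/
lemma IsD.exists_liouville {f g : A.L2} (h : A.IsD f g) :
    ∃ c : ℝ, ∀ᵐ x, A.amp x * f x = c + ∫ t in (0 : ℝ)..x, A.dsigma t * (A.amp t * g t) := by
  have hw := (A.isD_iff f g).mp h
  obtain ⟨c, hc⟩ := hw.exists_primitive
  set f' : ℝ → ℝ := fun x => A.dsigma x * (g x - Q1 A.ρ A.k x * f x) with hf'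
  set F : ℝ → ℝ := fun x => c + ∫ t in (0 : ℝ)..x, f' t with hF
  have hamp : ∀ x, AbsolutelyContinuousOnInterval A.amp 0 x := fun x => by
    refine ContDiffOn.absolutelyContinuousOnInterval (ContDiff.contDiffOn ?_)
    rw [contDiff_one_iff_deriv]
    refine ⟨fun y => (A.hasDerivAt_amp y).differentiableAt, ?_⟩
    have e : deriv A.amp = fun x => A.dsigma x * Q1 A.ρ A.k x * A.amp x :=
      funext fun y => (A.hasDerivAt_amp y).deriv
    rw [e]
    exact (A.dsigma_continuous.mul A.Q1_continuous).mul A.amp_continuous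
  refine ⟨A.amp 0 * c, ?_⟩
  filter_upwards [hc] with x hx
  have h1 := (hamp x).integral_deriv_mul_eq_sub (ac_primitive hw.2.1 c 0 x)
  have h2 : ∫ t in (0 : ℝ)..x, (deriv A.amp t * F t + A.amp t * deriv F t) =
      ∫ t in (0 : ℝ)..x, A.dsigma t * (A.amp t * g t) := by
    refine intervalIntegral.integral_congr_ae ?_
    filter_upwards [hc, deriv_primitive hw.2.1 c] with t h3 h4 _
    rw [h4, ← h3, (A.hasDerivAt_amp t).deriv]
    simp only [hf']
    ring
  have h3 : F 0 = c := by simp [hF]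
  rw [← h2, hx]
  change _ = A.amp 0 * c + ∫ t in (0 : ℝ)..x, (deriv A.amp t * F t + A.amp t * deriv F t)
  rw [h1]
  change A.amp x * F x = A.amp 0 * c + (A.amp x * F x - A.amp 0 * F 0)
  rw [h3]
  ring

/-- Primitives `∫₀ˣ (ρk)^{1/4} g dσ` are locally bounded by the norm of `g`. -/
lemma exists_bound_primitive (X : ℝ) : ∃ C, 0 ≤ C ∧ ∀ g : A.L2, ∀ x ∈ Icc 0 X,
    |∫ t in (0 : ℝ)..x, A.dsigma t * (A.amp t * g t)| ≤ C * ‖g‖ := by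
  -- the function `√(ρ/k) (ρk)^{1/4} / ρ`, cut off outside `[0, X]`, lies in `L²_ρ`
  let b : ContDiffBump (0 : ℝ) := ⟨|X| + 1, |X| + 2, by positivity, by linarith⟩
  have hbc : HasCompactSupport fun x => (A.ρ x)⁻¹ * (A.dsigma x * A.amp x) * b x :=
    b.hasCompactSupport.mul_left
  have hcont : Continuous fun x => (A.ρ x)⁻¹ * (A.dsigma x * A.amp x) * b x :=
    ((A.ρ_continuous.inv₀ fun x => (A.ρ_pos' x).ne').mul
      (A.dsigma_continuous.mul A.amp_continuous)).mul b.continuous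
  refine ⟨‖A.testL2 _ hcont hbc‖, norm_nonneg _, fun g x hx => ?_⟩
  have habs := A.volume_ac.ae_eq (Lp.coeFn_abs g)
  have hinner := A.inner_testL2 _ hcont hbc |g|
  have hint : Integrable fun t => A.ρ t * ((A.ρ t)⁻¹ * (A.dsigma t * A.amp t) * b t * |g| t) := by
    refine (integrable_mul_test (A.locallyIntegrable_L2 |g|) (A.ρ_continuous.mul hcont)
      hbc.mul_left).congr (Eventually.of_forall fun t => ?_)
    simp only [Pi.mul_apply]
    ring
  calc |∫ t in (0 : ℝ)..x, A.dsigma t * (A.amp t * g t)|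
      ≤ ∫ t in (0 : ℝ)..x, |A.dsigma t * (A.amp t * g t)| :=
        intervalIntegral.abs_integral_le_integral_abs hx.1
    _ = ∫ t in (0 : ℝ)..x, A.ρ t * ((A.ρ t)⁻¹ * (A.dsigma t * A.amp t) * b t * |g| t) := by
        refine intervalIntegral.integral_congr_ae ?_
        filter_upwards [habs] with t ht htx
        rw [uIoc_of_le hx.1] at htx
        have hb : b t = 1 := b.one_of_mem_closedBall (by
          rw [Metric.mem_closedBall, dist_zero_right, Real.norm_eq_abs, abs_of_pos htx.1]
          change t ≤ |X| + 1
          have := le_abs_self X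
          linarith [htx.2, hx.2])
        have hρ := (A.ρ_pos' t).ne'
        have h1 : 0 < A.dsigma t * A.amp t := mul_pos (A.dsigma_pos t) (A.amp_pos t)
        rw [hb, ht, ← mul_assoc, abs_mul, abs_of_pos h1]
        field_simp
    _ ≤ ∫ t, A.ρ t * ((A.ρ t)⁻¹ * (A.dsigma t * A.amp t) * b t * |g| t) := by
        rw [intervalIntegral.integral_of_le hx.1]
        refine setIntegral_le_integral hint ?_
        filter_upwards [habs] with t ht
        rw [ht]
        have h1 := A.ρ_pos' t
        have h2 := A.dsigma_pos t
        have h3 := A.amp_pos t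
        have h4 : 0 ≤ b t := b.nonneg
        simp only [Pi.zero_apply]
        positivity
    _ ≤ _ := by
        rw [← hinner]
        refine (real_inner_le_norm _ _).trans_eq ?_
        rw [norm_abs_eq_norm]

lemma sigma_hasDerivAt (x : ℝ) : HasDerivAt (sigma A.ρ A.k) (A.dsigma x) x :=
  intervalIntegral.integral_hasDerivAt_right (A.dsigma_continuous.intervalIntegrable _ _)
    (A.dsigma_continuous.stronglyMeasurableAtFilter _ _) A.dsigma_continuous.continuousAt

/-- An integrand which agrees almost everywhere with a continuous function has a primitive that is
differentiable everywhere. -/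
lemma hasDerivAt_primitive_of_ae {c : ℝ} {g : A.L2} {F G : ℝ → ℝ} (hG : Continuous G)
    (hF : ∀ x, F x = c + ∫ t in (0 : ℝ)..x, A.dsigma t * (A.amp t * g t))
    (hg : ∀ᵐ x, A.amp x * g x = G x) (x : ℝ) : HasDerivAt F (A.dsigma x * G x) x := by
  have hcont : Continuous fun t => A.dsigma t * G t := A.dsigma_continuous.mul hG
  have e : F = fun x => c + ∫ t in (0 : ℝ)..x, A.dsigma t * G t := by
    funext y
    rw [hF]
    congr 1
    refine intervalIntegral.integral_congr_ae ?_
    filter_upwards [hg] with t ht _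
    rw [ht]
  rw [e]
  exact (intervalIntegral.integral_hasDerivAt_right (hcont.intervalIntegrable _ _)
    (hcont.stronglyMeasurableAtFilter _ _) hcont.continuousAt).const_add c

/-- Unique continuation: even states `h n = Λⁿ (h 0)` which all vanish at `0` and grow at most like
`n! Kⁿ` are zero. -/
lemma eq_zero_of_delta_eq_zero {h : ℕ → A.H1} {C K : ℝ} (hC : 0 ≤ C) (hK : 0 ≤ K)
    (heven : ∀ n, A.refl (h n) = h n) (hδ : ∀ n, A.delta (h n) = 0)
    (hΛ : ∀ n w, inner ℝ (A.triple.B (h n)) w = inner ℝ (A.incl (h (n + 1))) (A.incl w))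
    (hb : ∀ n, ‖h n‖ ≤ C * ((n + 2).factorial * K ^ n)) : h 0 = 0 := by
  -- `r n = 𝔻² (h n)`
  set r : ℕ → A.L2 := fun n =>
    A.qMul (A.incl (h n)) + A.shift • A.incl (h n) - A.incl (h (n + 1)) with hr
  have hD : ∀ n, A.IsD (A.D (h n)) (r n) := fun n => by
    refine A.isD_of_forall_inner fun w => ?_
    have := hΛ n w
    rw [inner_B] at this
    simp only [hr, inner_sub_left, inner_add_left, inner_smul_left, conj_trivial]
    linarith
  choose c hc using fun n => IsD.exists_liouville A (A.isD_H1 (h n))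
  choose e he using fun n => IsD.exists_liouville A (hD n)
  -- `F n` and `G n` are the continuous representatives of `(ρk)^{1/4} h n` and `(ρk)^{1/4} 𝔻 (h n)`
  set F : ℕ → ℝ → ℝ := fun n x =>
    c n + ∫ t in (0 : ℝ)..x, A.dsigma t * (A.amp t * A.D (h n) t) with hF
  set G : ℕ → ℝ → ℝ := fun n x =>
    e n + ∫ t in (0 : ℝ)..x, A.dsigma t * (A.amp t * r n t) with hG
  have hFc : ∀ n, Continuous (F n) := fun n =>
    continuous_primitive (A.locallyIntegrable_amp_mul _) (c n)
  have hGc : ∀ n, Continuous (G n) := fun n =>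
    continuous_primitive (A.locallyIntegrable_amp_mul _) (e n)
  have hF' : ∀ n x, HasDerivAt (F n) (A.dsigma x * G n x) x := fun n =>
    A.hasDerivAt_primitive_of_ae (hGc n) (fun x => rfl) (he n)
  have hG' : ∀ n x, HasDerivAt (G n)
      (A.dsigma x * ((A.q x + A.shift) * F n x - F (n + 1) x)) x := fun n => by
    refine A.hasDerivAt_primitive_of_ae (((A.q_continuous.add continuous_const).mul (hFc n)).sub
      (hFc (n + 1))) (fun x => rfl) ?_
    filter_upwards [hc n, hc (n + 1), A.qMul_coe (A.incl (h n)),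
      A.volume_ac.ae_eq (Lp.coeFn_sub (A.qMul (A.incl (h n)) + A.shift • A.incl (h n))
        (A.incl (h (n + 1)))),
      A.volume_ac.ae_eq (Lp.coeFn_add (A.qMul (A.incl (h n))) (A.shift • A.incl (h n))),
      A.volume_ac.ae_eq (Lp.coeFn_smul A.shift (A.incl (h n)))] with x h1 h2 h3 h4 h5 h6
    have h1' : F n x = A.amp x * A.incl (h n) x := h1.symm
    have h2' : F (n + 1) x = A.amp x * A.incl (h (n + 1)) x := h2.symm
    rw [h1', h2']
    change A.amp x * (A.qMul (A.incl (h n)) + A.shift • A.incl (h n) - A.incl (h (n + 1)) : A.L2) x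
      = _
    rw [h4, Pi.sub_apply, h5, Pi.add_apply, h3, h6, Pi.smul_apply, smul_eq_mul]
    ring
  have hF0 : ∀ n, F n 0 = 0 := fun n => by
    have h1 := A.delta_apply (h n) (fun x => (A.amp x)⁻¹ * F n x)
      ((A.amp_continuous.inv₀ fun x => (A.amp_pos x).ne').mul (hFc n)) (by
        filter_upwards [hc n] with x hx
        change (A.amp x)⁻¹ * (c n + ∫ t in (0 : ℝ)..x, _) = _
        rw [← hx, inv_mul_cancel_left₀ (A.amp_pos x).ne'])
    rw [hδ n] at h1
    simpa [(A.amp_pos 0).ne'] using h1.symm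
  -- `𝔻 (h n)` is odd, since `h n` is even
  have hG0 : ∀ n, G n 0 = 0 := fun n => by
    have hodd : (fun x => G n (-x)) =ᵐ[volume] fun x => -G n x := by
      have h1 := congrArg A.D (heven n)
      rw [D_refl] at h1
      have h2 := A.volume_ac.ae_eq (Lp.coeFn_neg (A.reflL2 (A.D (h n))))
      rw [h1] at h2
      filter_upwards [he n, ae_neg (he n), h2, A.reflL2_coe (A.D (h n))] with x h3 h4 h5 h6
      change e n + ∫ t in (0 : ℝ)..(-x), _ = -(e n + ∫ t in (0 : ℝ)..x, _)
      rw [← h3, ← h4, h5, Pi.neg_apply, h6, A.amp_even]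
      ring
    have h1 := congrFun (((hGc n).comp continuous_neg).ae_eq_iff_eq volume (hGc n).neg |>.mp hodd) 0
    simp only [Function.comp_apply, neg_zero, Pi.neg_apply] at h1
    linarith
  have hzero : ∀ X, ∀ x ∈ Icc 0 X, F 0 x = 0 := fun X => by
    obtain ⟨C', hC', hbd⟩ := A.exists_bound_primitive X
    refine eq_zero_of_cauchy_data (F := F) (G := G) (M := A.qBound + A.shift) (C := C' * C)
      (K := K) (fun x => (A.dsigma_pos x).le) A.sigma_hasDerivAt (by simp [sigma])
      (Q := fun x => A.q x + A.shift) (fun x => ?_) (by positivity) hK hF' hG' hF0 hG0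
      fun n x hx => ?_
    · refine (abs_add_le _ _).trans ?_
      have h1 : 0 ≤ A.shift := by have := A.qBound_nonneg; rw [shift]; linarith
      rw [abs_of_nonneg h1]
      linarith [A.abs_q_le x]
    · have hcn : c n = 0 := by simpa [hF] using hF0 n
      have h1 := hbd (A.D (h n)) x hx
      have h2 : ‖A.D (h n)‖ ≤ ‖h n‖ := by
        have := A.norm_sq_H1 (h n)
        exact le_of_sq_le_sq (by nlinarith [sq_nonneg ‖A.incl (h n)‖]) (norm_nonneg _)
      simp only [hF, hcn, zero_add]
      refine h1.trans ?_
      rw [mul_assoc]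
      exact mul_le_mul_of_nonneg_left (h2.trans (hb n)) hC'
  have hpos : ∀ᵐ x : ℝ, 0 ≤ x → A.incl (h 0) x = 0 := by
    filter_upwards [hc 0] with x hx hx0
    have h1 : A.amp x * A.incl (h 0) x = F 0 x := hx
    rw [hzero x x ⟨hx0, le_rfl⟩] at h1
    exact (mul_eq_zero.mp h1).resolve_left (A.amp_pos x).ne'
  refine A.incl_injective ?_
  rw [map_zero]
  refine A.ext_L2 ?_
  have h1 := A.reflL2_coe (A.incl (h 0))
  rw [← incl_refl, heven 0] at h1
  filter_upwards [hpos, ae_neg hpos, h1, A.volume_ac.ae_eq (Lp.coeFn_zero ℝ 2 A.μ)]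
    with x h2 h3 h4 h5
  rw [h5, Pi.zero_apply]
  rcases le_total 0 x with hx | hx
  · exact h2 hx
  · rw [h4]; exact h3 (neg_nonneg.mpr hx)

end Coefficients

/-! ### Solutions of the controlled evolution equation -/

namespace FormTriple

variable {V H : Type*} [NormedAddCommGroup V] [InnerProductSpace ℝ V]
  [NormedAddCommGroup H] [InnerProductSpace ℝ H] (P : FormTriple V H)

/-- `W` solves `W' = -Λ W + c W - u ℓ` in `V*` on `(0, T)`, and `W(0) = v`. -/
structure Solves (c : ℝ) (ℓ : StrongDual ℝ V) (T : ℝ) (u : ℝ → ℝ) (v : V) (W : ℝ → V) : Prop where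
  init : W 0 = v
  ac : AbsolutelyContinuousOnInterval (fun t => P.ofH (P.j (W t))) 0 T
  eq : ∀ᵐ t, t ∈ Ioo 0 T → HasDerivAt (fun t => P.ofH (P.j (W t)))
    (-P.form (W t) + c • P.ofH (P.j (W t)) - u t • ℓ) t

variable {P} {c T : ℝ} {ℓ : StrongDual ℝ V}

lemma form_add (v w : V) : P.form (v + w) = P.form v + P.form w := by simp [form]

lemma form_smul (a : ℝ) (v : V) : P.form (a • v) = a • P.form v := by simp [form]

lemma Solves.add {u u' : ℝ → ℝ} {v v' : V} {W W' : ℝ → V} (h : P.Solves c ℓ T u v W)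
    (h' : P.Solves c ℓ T u' v' W') : P.Solves c ℓ T (u + u') (v + v') (W + W') := by
  have e : (fun t => P.ofH (P.j ((W + W') t))) =
      fun t => P.ofH (P.j (W t)) + P.ofH (P.j (W' t)) := funext fun t => by simp
  refine ⟨by rw [Pi.add_apply, h.init, h'.init], ?_, ?_⟩
  · rw [e]; exact h.ac.add h'.ac
  · rw [e]
    filter_upwards [h.eq, h'.eq] with t h1 h2 ht
    refine ((h1 ht).add (h2 ht)).congr_deriv ?_
    simp only [Pi.add_apply, map_add, form_add]
    module

lemma Solves.smul {u : ℝ → ℝ} {v : V} {W : ℝ → V} (a : ℝ) (h : P.Solves c ℓ T u v W) :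
    P.Solves c ℓ T (a • u) (a • v) (a • W) := by
  have e : (fun t => P.ofH (P.j ((a • W) t))) = fun t => a • P.ofH (P.j (W t)) :=
    funext fun t => by simp
  refine ⟨by rw [Pi.smul_apply, h.init], ?_, ?_⟩
  · rw [e]; exact h.ac.const_smul a
  · rw [e]
    filter_upwards [h.eq] with t h1 ht
    refine ((h1 ht).const_smul a).congr_deriv ?_
    simp only [Pi.smul_apply, map_smul, form_smul, smul_eq_mul]
    module

variable [CompleteSpace V]

/-- The difference of two solutions for the same control solves the uncontrolled equation. -/
lemma Solves.eqOn {u : ℝ → ℝ} {v : V} {W W' : ℝ → V} (h : P.Solves c ℓ T u v W)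
    (h' : P.Solves c ℓ T u v W') : EqOn W' W (Icc 0 T) := by
  intro t ht
  have hd := h'.add (h.smul (-1))
  have := P.eq_zero_of_evolution (c := c) (by simpa using hd.init) hd.ac
    (by simpa using hd.eq) ht
  simpa [← sub_eq_add_neg, sub_eq_zero] using this

variable [CompleteSpace H]

lemma absolutelyContinuous_exp_semigroup (a : ℝ) (v : V) :
    AbsolutelyContinuousOnInterval
      (fun t => P.ofH (P.j (Real.exp (c * t) • P.semigroup (t - a) v))) 0 T := by
  obtain ⟨K, hK⟩ := P.exists_lipschitz_semigroup v
  have h1 : AbsolutelyContinuousOnInterval (fun t => Real.exp (c * t)) 0 T :=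
    ContDiffOn.absolutelyContinuousOnInterval (by fun_prop)
  have h2 := hK.comp (LipschitzWith.of_dist_le_mul (K := 1) (f := fun t : ℝ => t - a)
    fun x y => by simp)
  have h3 := h1.smul (h2.absolutelyContinuousOnInterval 0 T)
  have e : (fun t => P.ofH (P.j (Real.exp (c * t) • P.semigroup (t - a) v))) =
      (fun t => Real.exp (c * t)) •
        ((fun t => P.ofH (P.j (P.semigroup t v))) ∘ fun t : ℝ => t - a) :=
    funext fun t => by simp
  rw [e]
  exact h3

lemma hasDerivAt_exp_mul (c t : ℝ) :
    HasDerivAt (fun t => Real.exp (c * t)) (c * Real.exp (c * t)) t := by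
  have := ((hasDerivAt_id t).const_mul c).exp
  simpa [mul_comm] using this

lemma hasDerivAt_exp_semigroup {a t : ℝ} (hat : a < t) (v : V) :
    HasDerivAt (fun t => P.ofH (P.j (Real.exp (c * t) • P.semigroup (t - a) v)))
      (Real.exp (c * t) • (-P.form (P.semigroup (t - a) v) +
        c • P.ofH (P.j (P.semigroup (t - a) v)))) t := by
  have h1 := (P.hasDerivAt_ofH_semigroup (sub_pos.mpr hat) v).scomp t
    ((hasDerivAt_id t).sub_const a)
  have h2 := (hasDerivAt_exp_mul c t).smul h1
  have e : (fun t => P.ofH (P.j (Real.exp (c * t) • P.semigroup (t - a) v))) =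
      (fun t => Real.exp (c * t)) •
        ((fun t => P.ofH (P.j (P.semigroup t v))) ∘ fun t : ℝ => t - a) :=
    funext fun t => by simp
  rw [e]
  refine h2.congr_deriv ?_
  simp only [Function.comp_apply, id]
  module

variable (P)

/-- The uncontrolled solution `exp(ct) exp(-tΛ) v`. -/
lemma solves_free (c : ℝ) (ℓ : StrongDual ℝ V) (T : ℝ) (v : V) :
    P.Solves c ℓ T 0 v fun t => Real.exp (c * t) • P.semigroup t v := by
  refine ⟨by simp [P.semigroup_of_nonpos le_rfl], ?_, ?_⟩
  · have := P.absolutelyContinuous_exp_semigroup (c := c) (T := T) 0 v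
    simpa only [sub_zero] using this
  · refine Eventually.of_forall fun t ht => ?_
    have h := P.hasDerivAt_exp_semigroup (c := c) ht.1 v
    simp only [sub_zero] at h
    refine h.congr_deriv ?_
    simp only [map_smul, form_smul, Pi.zero_apply]
    module

/-- The control `exp(ct) 1_{t > a}`. -/
def stepControl (c a t : ℝ) : ℝ := (Ioi a).indicator (fun t => Real.exp (c * t)) t

lemma memLp_stepControl {c : ℝ} (hc : 0 ≤ c) (a T : ℝ) :
    MemLp (stepControl c a) ⊤ (volume.restrict (Ioo 0 T)) := by
  refine memLp_top_of_bound ?_ (Real.exp (c * T)) ?_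
  · exact (Measurable.indicator (by fun_prop) measurableSet_Ioi).aestronglyMeasurable
  · refine ae_restrict_of_forall_mem measurableSet_Ioo fun t ht => ?_
    refine (norm_indicator_le_norm_self _ _).trans ?_
    rw [Real.norm_eq_abs, Real.abs_exp]
    exact Real.exp_le_exp.mpr (mul_le_mul_of_nonneg_left ht.2.le hc)

/-- The response `-exp(ct) (p - exp(-(t - a)Λ) p)`, `p = Λ⁻¹ ℓ`, to a control which is switched on
at the time `a`. -/
lemma solves_step (c : ℝ) (ℓ : StrongDual ℝ V) (T : ℝ) {a : ℝ} (ha : 0 ≤ a) :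
    P.Solves c ℓ T (stepControl c a) 0 fun t =>
      -(Real.exp (c * t) • (P.solve ℓ - P.semigroup (t - a) (P.solve ℓ))) := by
  set p : V := P.solve ℓ with hp
  have e : (fun t => P.ofH (P.j (-(Real.exp (c * t) • (p - P.semigroup (t - a) p))))) =
      fun t => P.ofH (P.j (Real.exp (c * t) • P.semigroup (t - a) p)) -
        Real.exp (c * t) • P.ofH (P.j p) := by
    funext t
    simp only [map_smul, map_sub, map_neg]
    module
  refine ⟨by simp [P.semigroup_of_nonpos (neg_nonpos.mpr ha)], ?_, ?_⟩
  · rw [e]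
    exact (P.absolutelyContinuous_exp_semigroup a p).sub
      (ContDiffOn.absolutelyContinuousOnInterval (by fun_prop))
  · rw [e]
    -- the equation fails only at the switching time
    have hne : ∀ᵐ t : ℝ, t ≠ a := by simp [ae_iff, measure_singleton]
    filter_upwards [hne] with t hta _
    rcases lt_or_gt_of_ne hta with hlt | hgt
    · have e2 : (fun t => P.ofH (P.j (Real.exp (c * t) • P.semigroup (t - a) p)) -
          Real.exp (c * t) • P.ofH (P.j p)) =ᶠ[𝓝 t] fun _ => 0 := by
        filter_upwards [Iio_mem_nhds hlt] with s hs
        rw [P.semigroup_of_nonpos (sub_nonpos.mpr (le_of_lt hs))]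
        simp
      refine ((hasDerivAt_const t (0 : StrongDual ℝ V)).congr_of_eventuallyEq e2).congr_deriv ?_
      rw [P.semigroup_of_nonpos (sub_nonpos.mpr hlt.le)]
      simp [stepControl, hlt.le, form]
    · refine ((P.hasDerivAt_exp_semigroup hgt p).sub
        ((hasDerivAt_exp_mul c t).smul_const (P.ofH (P.j p)))).congr_deriv ?_
      have hu : stepControl c a t = Real.exp (c * t) := by simp [stepControl, hgt]
      have hform : P.form p = ℓ := by
        ext w
        exact P.inner_B_solve _ _
      have hsub : -(Real.exp (c * t) • (p - P.semigroup (t - a) p)) =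
          -Real.exp (c * t) • p + Real.exp (c * t) • P.semigroup (t - a) p := by
        module
      rw [hu, hsub, form_add, form_smul, form_smul, hform]
      simp only [map_add, map_smul]
      module

end FormTriple

namespace Coefficients

variable (A : Coefficients)

/-! ### Solutions of the control system and the reachable set -/

lemma embed_eq (f : A.H1) : A.embed f = A.triple.ofH (A.incl f) := rfl

/-- The constant `2 √((ρk)(0))`. -/
def kappa : ℝ := 2 * √(A.ρ 0 * A.k 0)

lemma kappa_pos : 0 < A.kappa :=
  mul_pos two_pos (Real.sqrt_pos.mpr (mul_pos (A.ρ_pos' 0) (A.k_pos' 0)))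

/-- The right-hand side is `-Λ f + λ f - κ c δ`. -/
lemma rhs_eq (f : A.H1) (c : ℝ) : A.rhs f c =
    -A.triple.form f + A.shift • A.embed f - (A.kappa * c) • A.delta := by
  have e : -A.triple.form f + A.shift • A.embed f =
      A.Dm (A.D f) - A.ofL2 (A.qMul (A.incl f)) := by
    ext w
    change -inner ℝ (A.triple.B f) w + A.shift * inner ℝ (A.incl f) (A.incl w) =
      -inner ℝ (A.D f) (A.D w) - inner ℝ (A.qMul (A.incl f)) (A.incl w)
    rw [inner_B]
    ring
  rw [e]
  rfl

/-- The control system is the abstract evolution equation for `c = λ` and `ℓ = κ δ`. -/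
lemma isSolution_iff {T : ℝ} {u : ℝ → ℝ} {W0 : A.EvenH1} {W : ℝ → A.EvenH1} :
    A.IsSolution T u W0 W ↔
      A.triple.Solves A.shift (A.kappa • A.delta) T u (W0 : A.H1) fun t => (W t : A.H1) := by
  have e : (fun t => A.embed (W t)) = fun t => A.triple.ofH (A.triple.j (W t : A.H1)) :=
    funext fun t => A.embed_eq _
  have er : ∀ t, A.rhs (W t) (u t) = -A.triple.form (W t : A.H1) +
      A.shift • A.triple.ofH (A.triple.j (W t : A.H1)) - u t • A.kappa • A.delta := fun t => by
    rw [rhs_eq, embed_eq, triple_j, smul_smul, mul_comm]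
  rw [IsSolution, e]
  simp only [er]
  exact ⟨fun h => ⟨congrArg Subtype.val h.1, h.2.1, h.2.2⟩,
    fun h => ⟨Subtype.ext h.init, h.ac, h.eq⟩⟩

/-- The semigroup `exp(-tΛ)` on `Ĥ¹`. -/
def evenSemigroup (t : ℝ) (v : A.EvenH1) : A.EvenH1 :=
  ⟨A.triple.semigroup t v,
    (A.mem_evenH1_iff _).mpr (A.semigroup_refl t ((A.mem_evenH1_iff _).mp v.2))⟩

/-- The state `Λ⁻¹ (κ δ)`, which is a multiple of the Green function of `Λ` with pole at `0`. -/
def green : A.EvenH1 :=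
  ⟨A.triple.solve (A.kappa • A.delta), (A.mem_evenH1_iff _).mpr (A.solve_refl fun w => by
    change A.kappa * A.delta (A.refl w) = A.kappa * A.delta w
    rw [delta_refl])⟩

lemma isSolution_free (T : ℝ) (W0 : A.EvenH1) :
    A.IsSolution T 0 W0 fun t => Real.exp (A.shift * t) • A.evenSemigroup t W0 :=
  A.isSolution_iff.mpr (A.triple.solves_free A.shift (A.kappa • A.delta) T W0)

lemma isSolution_step (T : ℝ) {a : ℝ} (ha : 0 ≤ a) :
    A.IsSolution T (FormTriple.stepControl A.shift a) 0 fun t =>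
      -(Real.exp (A.shift * t) • (A.green - A.evenSemigroup (t - a) A.green)) :=
  A.isSolution_iff.mpr (A.triple.solves_step A.shift (A.kappa • A.delta) T ha)

variable {A}

lemma IsSolution.add {T : ℝ} {u u' : ℝ → ℝ} {W0 W0' : A.EvenH1} {W W' : ℝ → A.EvenH1}
    (h : A.IsSolution T u W0 W) (h' : A.IsSolution T u' W0' W') :
    A.IsSolution T (u + u') (W0 + W0') (W + W') :=
  A.isSolution_iff.mpr ((A.isSolution_iff.mp h).add (A.isSolution_iff.mp h'))

lemma IsSolution.smul {T : ℝ} {u : ℝ → ℝ} {W0 : A.EvenH1} {W : ℝ → A.EvenH1} (c : ℝ)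
    (h : A.IsSolution T u W0 W) : A.IsSolution T (c • u) (c • W0) (c • W) :=
  A.isSolution_iff.mpr ((A.isSolution_iff.mp h).smul c)

lemma IsSolution.eqOn {T : ℝ} {u : ℝ → ℝ} {W0 : A.EvenH1} {W V : ℝ → A.EvenH1}
    (hW : A.IsSolution T u W0 W) (hV : A.IsSolution T u W0 V) : EqOn V W (Icc 0 T) :=
  fun _ ht => Subtype.ext ((A.isSolution_iff.mp hW).eqOn (A.isSolution_iff.mp hV) ht)

variable (A)

/-! ### Approximate controllability -/

/-- The states which are reached from the origin in the time `T`. -/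
def reachedFromZero (T : ℝ) : Submodule ℝ A.EvenH1 where
  carrier := {z | ∃ u : ℝ → ℝ, MemLp u ⊤ (volume.restrict (Ioo 0 T)) ∧
    ∃ W : ℝ → A.EvenH1, A.IsSolution T u 0 W ∧ W T = z}
  add_mem' := by
    rintro z z' ⟨u, hu, W, hW, rfl⟩ ⟨u', hu', W', hW', rfl⟩
    exact ⟨u + u', hu.add hu', W + W', by simpa using hW.add hW', rfl⟩
  zero_mem' := by
    refine ⟨0, MemLp.zero, _, A.isSolution_free T 0, ?_⟩
    refine Subtype.ext ?_
    have h : A.triple.semigroup T (0 : A.H1) = 0 := by simp [FormTriple.semigroup]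
    simp [evenSemigroup, h]
  smul_mem' := by
    rintro c z ⟨u, hu, W, hW, rfl⟩
    exact ⟨c • u, hu.const_smul c, c • W, by simpa using hW.smul c, rfl⟩

lemma green_sub_mem {T t : ℝ} (ht : t ∈ Icc 0 T) :
    A.green - A.evenSemigroup t A.green ∈ A.reachedFromZero T := by
  have hs : 0 ≤ A.shift := add_nonneg A.qBound_nonneg zero_le_one
  -- switch the control on at the time `T - t`
  have h : -(Real.exp (A.shift * T) • (A.green - A.evenSemigroup (T - (T - t)) A.green)) ∈
      A.reachedFromZero T :=
    ⟨_, FormTriple.memLp_stepControl hs (T - t) T, _,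
      A.isSolution_step T (sub_nonneg.mpr ht.2), rfl⟩
  rw [sub_sub_cancel, neg_mem_iff] at h
  exact ((A.reachedFromZero T).smul_mem_iff (Real.exp_pos _).ne').mp h

lemma add_mem_reachableSet {T : ℝ} (W0 : A.EvenH1) {z : A.EvenH1} (hz : z ∈ A.reachedFromZero T) :
    Real.exp (A.shift * T) • A.evenSemigroup T W0 + z ∈ A.reachableSet T W0 := by
  obtain ⟨u, hu, W, hW, rfl⟩ := hz
  have h := (A.isSolution_free T W0).add hW
  rw [zero_add, add_zero] at h
  exact ⟨u, hu, _, h, fun V hV => h.eqOn hV, rfl⟩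

/-- An even state `y` with `b(y, p - exp(-tΛ) p) = 0` for `0 < t < T`, where `p` is `green`, is
zero. -/
lemma eq_zero_of_orthogonal {T : ℝ} (hT : 0 < T) {y : A.H1} (hy : A.refl y = y)
    (h : ∀ t ∈ Ioo 0 T, inner ℝ (A.triple.B y)
      ((A.green - A.evenSemigroup t A.green : A.EvenH1) : A.H1) = 0) : y = 0 := by
  refine A.triple.eq_zero_of_semigroup hT y fun t ht => ?_
  refine A.triple.semigroup_eq_zero_of_orbit ht.1 y ?_
  have ht0 := ht.1
  refine A.eq_zero_of_delta_eq_zero (h := A.triple.orbit t y)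
    (C := (t ^ 2)⁻¹ * ‖A.incl y‖) (K := t⁻¹) (by positivity) (by positivity)
    (fun n => A.E_heat_refl t (n + 2) hy)
    (fun n => (smul_eq_zero.mp
      (A.triple.apply_orbit_eq_zero (A.kappa • A.delta) y h n t ht)).resolve_left A.kappa_pos.ne')
    (fun n w => A.triple.inner_B_orbit ht.1 y n w) fun n => ?_
  refine (A.triple.norm_orbit_le ht.1 y n).trans_eq ?_
  rw [triple_j, pow_add, inv_pow]
  field_simp

lemma refl_add (f g : A.H1) : A.refl (f + g) = A.refl f + A.refl g :=
  A.incl_injective (by simp)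

lemma refl_refl (f : A.H1) : A.refl (A.refl f) = f :=
  A.incl_injective (by simp [reflL2_reflL2])

/-- Only the even part of a vector orthogonal to the reached states has to vanish, as these states
and the target are even. -/
lemma dense_reachedFromZero {T : ℝ} (hT : 0 < T) (v : A.EvenH1) :
    v ∈ closure (A.reachedFromZero T : Set A.EvenH1) := by
  rw [closure_subtype]
  set M : Submodule ℝ A.H1 := (A.reachedFromZero T).map A.EvenH1.subtype with hM
  suffices hv : (v : A.H1) ∈ M.topologicalClosure by
    rw [← SetLike.mem_coe, Submodule.topologicalClosure_coe] at hv
    simpa [hM] using! hv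
  rw [← Submodule.orthogonal_orthogonal_eq_closure, Submodule.mem_orthogonal]
  intro y hy
  have hvr : A.refl v = v := (A.mem_evenH1_iff _).mp v.2
  -- `b(z, ·) = ⟪y, ·⟫` turns orthogonality in `ℍ¹` into orthogonality for the form
  set z : A.H1 := A.triple.B.symm y with hz
  have hBz : A.triple.B z = y := A.triple.B.apply_symm_apply y
  have hM0 : ∀ m : A.EvenH1, m ∈ A.reachedFromZero T → inner ℝ y (m : A.H1) = 0 := fun m hm =>
    M.inner_left_of_mem_orthogonal (Submodule.mem_map_of_mem hm) hy
  -- the even part of `z` is orthogonal to the reachable states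
  have hz0 : z + A.refl z = 0 := by
    refine A.eq_zero_of_orthogonal hT ?_ fun t ht => ?_
    · rw [refl_add, refl_refl, add_comm]
    · have h1 := A.green_sub_mem (Ioo_subset_Icc_self ht)
      have h2 : A.refl (A.green - A.evenSemigroup t A.green : A.EvenH1) =
          (A.green - A.evenSemigroup t A.green : A.EvenH1) :=
        (A.mem_evenH1_iff _).mp (A.green - A.evenSemigroup t A.green : A.EvenH1).2
      rw [map_add, inner_add_left, inner_B_refl, h2, hBz, hM0 _ h1, add_zero]
  have h3 : inner ℝ (A.triple.B (z + A.refl z)) (v : A.H1) = 0 := by simp [hz0]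
  rw [map_add, inner_add_left, inner_B_refl, hvr, hBz] at h3
  linarith

end Coefficients

end HeatControl

end

theorem mainTheorem1 (A : HeatControl.Coefficients) (T : ℝ) (hT : 0 < T) (W0 WT : A.EvenH1) :
    A.ApproxControllable T W0 WT := by
  set f : A.EvenH1 := Real.exp (A.shift * T) • A.evenSemigroup T W0 with hf
  have h1 := A.dense_reachedFromZero hT (WT - f)
  have h2 : f + (WT - f) ∈ closure ((fun z => f + z) '' (A.reachedFromZero T : Set A.EvenH1)) :=
    image_closure_subset_closure_image (continuous_const.add continuous_id) ⟨_, h1, rfl⟩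
  rw [add_sub_cancel] at h2
  refine closure_mono ?_ h2
  rintro - ⟨z, hz, rfl⟩
  exact A.add_mem_reachableSet W0 hz
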